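/- **Setting.** Let $M\ge 1$, $\alpha>2$, $\delta=2/\alpha$, $\lambda_J>0$, $P_J>0$, $\beta\ge 0$. A receiver is at the origin of the plane. A transmitter has $M$ antennas at fixed positions at distances $r_{a_m,o}>0$ from the receiver, with transmit powers $P_{D_m}>0$, $m=1,\dots,M$. Interferers of transmit power $P_J$ are located at the points $\{\mathbb L_j\}$ of a homogeneous Poisson point process $\Phi_J$ of density $\lambda_J$ on the whole plane, and $r_{j,o}$ is the distance of $\mathbb L_j$ to the receiver. The fading coefficients $h_{a_m,o}$ ($m=1,\dots,M$) and $h_{j,o}$ (one per interferer) are i.i.d. circularly symmetric complex Gaussian with zero mean and unit variance (Rayleigh fading), and are independent of $\Phi_J$. With the distributed beamforming weights $g_m=h_{a_m,o}^{\dagger}/|h_{a_m,o}|$ put $$S_o=\Big|\sum_{m=1}^M\sqrt{P_{D_m}}\,g_m h_{a_m,o}\,r_{a_m,o}^{-\alpha/2}\Big|^2,\qquad I_o=\sum_{\mathbb L_j\in\Phi_J}P_J|h_{j,o}|^2r_{j,o}^{-\alpha}.$$ Thermal noise is neglected, and the connectivity probability is $\mathcal C=\mathbb P\{S_o/I_o\ge\beta\}$.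 **Theorem (connectivity probability of the distributed antenna system).** One has $$\mathcal C=1-\int_{\mathcal V}\frac{\psi_2\,e^{-\kappa\psi_0\beta^{\delta}}}{\psi_1^{M}}\sum_{n=1}^{M}\big(\delta\kappa\psi_0\beta^{\delta}\big)^n\,\Upsilon_{M,n}\,dv_1\cdots dv_M,$$ where the integrand is Lebesgue integrable over $\mathcal V=\{v\in\mathbb R^M: v_1\ge0,\dots,v_M\ge0,\ \sum_{m=1}^M v_m<1\}$, and $$\kappa=\pi\,\Gamma(1+\delta)\Gamma(1-\delta),\quad \psi_0=\lambda_JP_J^{\delta}\psi_1^{\delta},\quad \psi_1=\sum_{m=1}^M\frac{r_{a_m,o}^{\alpha}v_m^2}{P_{D_m}},\quad \psi_2=\prod_{m=1}^M\frac{2r_{a_m,o}^{\alpha}v_m}{P_{D_m}},$$ $$\Upsilon_{m,n}=\sum_{\substack{\psi\subseteq\{1,\dots,m-1\}\\|\psi|=m-n}}\ \prod_{i=1}^{m-n}\big[l_i-\delta(l_i-i+1)\big],\qquad \psi=\{l_1<\dots<l_{m-n}\},\qquad \Upsilon_{m,m}=1 .$$ -/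

import Mathlib

open MeasureTheory ProbabilityTheory
open scoped ENNReal NNReal ComplexConjugate

namespace CovertDAS

noncomputable section

/-- The plane on which the network lives; the receiver Bob sits at the origin. -/
abbrev Plane : Type := EuclideanSpace ℝ (Fin 2)

/-- The standard circularly symmetric complex Gaussian law `CN(0,1)` (Rayleigh fading):
independent real and imaginary parts, each centred with variance `1/2`. -/
def stdComplexGaussian : Measure ℂ :=
  ((gaussianReal 0 (1 / 2)).prod (gaussianReal 0 (1 / 2))).map fun p : ℝ × ℝ => (⟨p.1, p.2⟩ : ℂ)

section Probability

variable {Ω : Type*} [MeasurableSpace Ω]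

/-- Number of points of the enumerated random configuration `(L j)` that fall into `B`. -/
def pointCount (L : ℕ → Ω → Plane) (B : Set Plane) (ω : Ω) : ℕ∞ :=
  {j | L j ω ∈ B}.encard

/-- `(L j)` enumerates a homogeneous Poisson point process of density `lam` on the whole plane:
the number of points in a Borel set of finite area is Poisson with mean `lam` times the area, and
the numbers of points in pairwise disjoint such sets are independent.
(When `lam > 0` there are almost surely infinitely many points, so `ℕ` is the right index set.) -/
structure IsHomogeneousPPP (L : ℕ → Ω → Plane) (lam : ℝ≥0) (μ : Measure Ω) : Prop where
  measurable : ∀ j, Measurable (L j)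
  hasLaw_count : ∀ B : Set Plane, MeasurableSet B → volume B ≠ ∞ →
    HasLaw (pointCount L B)
      ((poissonMeasure (lam * (volume B).toNNReal)).map fun k : ℕ => (k : ℕ∞)) μ
  indep_count : ∀ (n : ℕ) (B : Fin n → Set Plane), (∀ i, MeasurableSet (B i)) →
    (∀ i, volume (B i) ≠ ∞) → Pairwise (fun i j => Disjoint (B i) (B j)) →
    iIndepFun (fun i => pointCount L (B i)) μ

/-- Distributed beamforming weight `h† / |h|`. -/
def dbfWeight (h : ℂ) : ℂ := conj h / (‖h‖ : ℂ)

/-- Power of the desired signal at Bob,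
`S_o = |∑ₘ √Pₘ gₘ hₘ rₘ^{-α/2}|²`, with `rₘ = ‖a m‖` the distance of the `m`-th antenna to Bob. -/
def signalPower {M : ℕ} (α : ℝ) (P : Fin M → ℝ) (a : Fin M → Plane)
    (h : Fin M → Ω → ℂ) (ω : Ω) : ℝ :=
  ‖∑ m, (Real.sqrt (P m) : ℂ) * dbfWeight (h m ω) * h m ω * ((‖a m‖ ^ (-α / 2) : ℝ) : ℂ)‖ ^ 2

/-- Aggregate interference power at Bob, `I_o = ∑ⱼ P_J |hⱼ|² rⱼ^{-α}`, as an unconditionally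
meaningful sum of nonnegative terms (a priori possibly infinite). -/
def interferencePower (α PJ : ℝ) (L : ℕ → Ω → Plane) (h : ℕ → Ω → ℂ) (ω : Ω) : ℝ≥0∞ :=
  ∑' j, ENNReal.ofReal (PJ * ‖h j ω‖ ^ 2 * ‖L j ω‖ ^ (-α))

/-- Signal-to-interference-plus-noise ratio `S / (I + σ²)`. -/
def sinr (S : Ω → ℝ) (I : Ω → ℝ≥0∞) (noise : ℝ≥0∞) (ω : Ω) : ℝ≥0∞ :=
  ENNReal.ofReal (S ω) / (I ω + noise)

/-- Connectivity probability: the probability that the SINR is at least the threshold `β`. -/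
def connectivityProb (μ : Measure Ω) (S : Ω → ℝ) (I : Ω → ℝ≥0∞) (noise : ℝ≥0∞) (β : ℝ) : ℝ :=
  μ.real {ω | ENNReal.ofReal β ≤ sinr S I noise ω}

end Probability

/-- `κ = π Γ(1+δ) Γ(1-δ)`. -/
def kappa (δ : ℝ) : ℝ := Real.pi * Real.Gamma (1 + δ) * Real.Gamma (1 - δ)

/-- The position of `l` in the increasing enumeration of `s` (counted from 1, for `l ∈ s`). -/
def rankIn (s : Finset ℕ) (l : ℕ) : ℕ := (s.filter (· ≤ l)).card

/-- `Υ_{m,n}`: sum over the subsets `s` of `{1,…,m-1}` of cardinality `m-n` of the products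
`∏ᵢ [lᵢ - δ (lᵢ - i + 1)]`, where `lᵢ` is the `i`-th smallest element of `s`. -/
def upsilon (δ : ℝ) (m n : ℕ) : ℝ :=
  ∑ s ∈ (Finset.Icc 1 (m - 1)).powersetCard (m - n),
    ∏ l ∈ s, ((l : ℝ) - δ * ((l : ℝ) - (rankIn s l : ℝ) + 1))

section Integrand

variable {M : ℕ}

/-- The domain `{v₁ ≥ 0, …, v_M ≥ 0, ∑ vₘ < 1}`. -/
def simplexDomain (M : ℕ) : Set (Fin M → ℝ) := {v | (∀ m, 0 ≤ v m) ∧ ∑ m, v m < 1}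

/-- `ψ₁ = ∑ₘ rₘ^α vₘ² / Pₘ`. -/
def psi1 (α : ℝ) (P r : Fin M → ℝ) (v : Fin M → ℝ) : ℝ := ∑ m, r m ^ α * v m ^ 2 / P m

/-- `ψ₂ = ∏ₘ 2 rₘ^α vₘ / Pₘ`. -/
def psi2 (α : ℝ) (P r : Fin M → ℝ) (v : Fin M → ℝ) : ℝ := ∏ m, 2 * r m ^ α * v m / P m

/-- `ψ₀ = λ_J P_J^δ ψ₁^δ` with `δ = 2/α`. -/
def psi0 (α lam PJ : ℝ) (P r : Fin M → ℝ) (v : Fin M → ℝ) : ℝ :=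
  lam * PJ ^ (2 / α) * psi1 α P r v ^ (2 / α)

/-- The integrand
`ψ₂ e^{-κψ₀β^δ} ψ₁^{-M} ∑_{n=1}^M (δκψ₀β^δ)^n Υ_{M,n}`, with `δ = 2/α`. -/
def dasIntegrand (α lam PJ β : ℝ) (P r : Fin M → ℝ) (v : Fin M → ℝ) : ℝ :=
  psi2 α P r v * Real.exp (-(kappa (2 / α) * psi0 α lam PJ P r v * β ^ (2 / α)))
      / psi1 α P r v ^ M
    * ∑ n ∈ Finset.Icc 1 M,
        (2 / α * kappa (2 / α) * psi0 α lam PJ P r v * β ^ (2 / α)) ^ n * upsilon (2 / α) M n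

end Integrand

end

end CovertDAS

namespace CovertDAS

noncomputable section

open Filter Topology

/-! The weights cancel the phases, so `S` is the square of a sum of independent scaled Rayleigh
moduli. Rescaling by `√t` writes `P(S < t)` as the integral of `t^M ψ₂ e^{-tψ₁}` over a simplex that
does not depend on `t` (`measure_signalPower_lt`). As `S` and `I` are independent, one may put `t =
βI` and average. By Tonelli the outage probability is the integral over the simplex of `ψ₂ β^M E[I^M
e^{-βψ₁I}]`.

The expectation is `(-1)^M` times the `M`-th derivative at `βψ₁` of the Laplace transform of `I`.
That transform is `e^{-K s^δ}` with `K = λ κ P_J^δ` (`lintegral_expNeg_interferencePower`):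
averaging over the fading leaves a functional of the Poisson points alone, which
`IsHomogeneousPPP.lintegral_expNeg_tsum` evaluates. The numbers `Υ_{m,n}` are the coefficients
produced by repeated differentiation of `e^{-K s^δ}`, because they satisfy the same recurrence
(`upsilon_succ_succ`).

Finiteness and nonvanishing of `I` are not assumed. Laplace transforms are taken on `[0, ∞]`, and
both facts follow almost surely from the limits `s → 0` and `s → ∞`. -/

/-- The function `x ↦ e^{-x}` on `[0, ∞]`, with `e^{-∞} = 0`. -/
def expNeg (x : ℝ≥0∞) : ℝ≥0∞ := EReal.exp (-(x : EReal))

@[simp] lemma expNeg_top : expNeg ∞ = 0 := by simp [expNeg]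

@[simp] lemma expNeg_zero : expNeg 0 = 1 := by simp [expNeg]

lemma expNeg_ofReal {x : ℝ} (hx : 0 ≤ x) :
    expNeg (ENNReal.ofReal x) = ENNReal.ofReal (Real.exp (-x)) := by
  rw [expNeg, EReal.coe_ennreal_ofReal, max_eq_left hx, ← EReal.coe_neg, EReal.exp_coe]

lemma expNeg_of_ne_top {x : ℝ≥0∞} (hx : x ≠ ∞) :
    expNeg x = ENNReal.ofReal (Real.exp (-x.toReal)) := by
  rw [← expNeg_ofReal ENNReal.toReal_nonneg, ENNReal.ofReal_toReal hx]

lemma expNeg_add (x y : ℝ≥0∞) : expNeg (x + y) = expNeg x * expNeg y := by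
  rw [expNeg, expNeg, expNeg, EReal.coe_ennreal_add, EReal.neg_add, sub_eq_add_neg, EReal.exp_add]
  · left; exact EReal.coe_ennreal_ne_bot x
  · right; exact EReal.coe_ennreal_ne_bot y

lemma expNeg_sum {ι : Type*} (s : Finset ι) (f : ι → ℝ≥0∞) :
    expNeg (∑ i ∈ s, f i) = ∏ i ∈ s, expNeg (f i) := by
  classical
  induction s using Finset.induction_on with
  | empty => simp
  | insert i s hi ih => rw [Finset.sum_insert hi, Finset.prod_insert hi, expNeg_add, ih]

lemma expNeg_antitone : Antitone expNeg := fun x y h => by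
  unfold expNeg
  apply EReal.exp_monotone
  simpa using h

lemma expNeg_le_one (x : ℝ≥0∞) : expNeg x ≤ 1 := by
  simpa using expNeg_antitone (zero_le : 0 ≤ x)

lemma continuous_expNeg : Continuous expNeg := by
  unfold expNeg
  exact ENNReal.continuous_exp.comp (continuous_neg.comp continuous_coe_ennreal_ereal)

lemma measurable_expNeg : Measurable expNeg := continuous_expNeg.measurable

lemma expNeg_nat_mul (n : ℕ) (c : ℝ≥0∞) : expNeg (c * n) = expNeg c ^ n := by
  rw [mul_comm, ← nsmul_eq_mul, ← Finset.card_range n, ← Finset.sum_const, expNeg_sum,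
    Finset.prod_const]

lemma toENNReal_pointCount {Ω : Type*} (L : ℕ → Ω → Plane) (B : Set Plane) (ω : Ω) :
    (pointCount L B ω : ℝ≥0∞) = ∑' j, B.indicator (fun _ => (1 : ℝ≥0∞)) (L j ω) := by
  have : ∀ j, B.indicator (fun _ => (1 : ℝ≥0∞)) (L j ω)
      = ({j | L j ω ∈ B} : Set ℕ).indicator (fun _ => (1 : ℝ≥0∞)) j := fun j => rfl
  simp_rw [this]
  rw [← tsum_subtype, ENNReal.tsum_set_const, mul_one]
  rfl

/-! ### Laplace functional of the Poisson process -/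

section PointProcess

variable {Ω : Type*} [MeasurableSpace Ω] {μ : Measure Ω}

lemma measurable_pointCount {L : ℕ → Ω → Plane} (hL : ∀ j, Measurable (L j)) {B : Set Plane}
    (hB : MeasurableSet B) : Measurable (pointCount L B) := by
  have h : Measurable fun ω => (pointCount L B ω : ℝ≥0∞) := by
    simp_rw [toENNReal_pointCount]
    exact Measurable.tsum fun j => (measurable_const.indicator hB).comp (hL j)
  refine measurable_to_countable' fun k => ?_
  have : pointCount L B ⁻¹' {k} = (fun ω => (pointCount L B ω : ℝ≥0∞)) ⁻¹' {(k : ℝ≥0∞)} := by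
    ext ω; simp
  rw [this]
  exact h (measurableSet_singleton _)

/-- With `q = e^{-c}` this is the generating function `∑ e^{-m} (mq)^k / k! = e^{-m(1-q)}`. The
value `c = ∞` is covered by `q = 0`. -/
lemma lintegral_expNeg_poisson (m : ℝ≥0) (c : ℝ≥0∞) :
    ∫⁻ k, expNeg (c * (k : ℕ)) ∂(poissonMeasure m) = expNeg (m * (1 - expNeg c)) := by
  have hc : expNeg c ≠ ∞ := (expNeg_le_one c).trans_lt ENNReal.one_lt_top |>.ne
  set q := (expNeg c).toReal with hq
  have hq0 : 0 ≤ q := ENNReal.toReal_nonneg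
  have hcq : expNeg c = ENNReal.ofReal q := (ENNReal.ofReal_toReal hc).symm
  have hq1 : q ≤ 1 := ENNReal.toReal_le_of_le_ofReal zero_le_one (by simpa using expNeg_le_one c)
  rw [poissonMeasure, lintegral_sum_measure]
  simp_rw [lintegral_smul_measure, lintegral_dirac, expNeg_nat_mul, hcq]
  have h1 : ∀ n : ℕ, ENNReal.ofReal (Real.exp (-(m : ℝ)) * m ^ n / n.factorial) • ENNReal.ofReal q ^ n
      = ENNReal.ofReal (Real.exp (-(m : ℝ)) * ((m * q) ^ n / n.factorial)) := fun n => by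
    rw [smul_eq_mul, ← ENNReal.ofReal_pow hq0, ← ENNReal.ofReal_mul (by positivity)]
    congr 1; ring
  simp_rw [h1]
  have hs := (NormedSpace.expSeries_div_hasSum_exp ((m : ℝ) * q)).mul_left (Real.exp (-(m : ℝ)))
  rw [← ENNReal.ofReal_tsum_of_nonneg (fun n => by positivity) hs.summable, hs.tsum_eq,
    ← Real.exp_eq_exp_ℝ, ← Real.exp_add, ← ENNReal.ofReal_one, ← ENNReal.ofReal_sub _ hq0,
    ← ENNReal.ofReal_coe_nnreal, ← ENNReal.ofReal_mul (by positivity), expNeg_ofReal]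
  · congr 2; ring
  · exact mul_nonneg m.2 (by linarith)

variable {L : ℕ → Ω → Plane} {lam : ℝ≥0}

lemma IsHomogeneousPPP.lintegral_expNeg_pointCount (hL : IsHomogeneousPPP L lam μ)
    {B : Set Plane} (hB : MeasurableSet B) (hv : volume B ≠ ∞) (c : ℝ≥0∞) :
    ∫⁻ ω, expNeg (c * pointCount L B ω) ∂μ = expNeg (lam * (volume B * (1 - expNeg c))) := by
  have hm : Measurable fun k : ℕ∞ => expNeg (c * (k : ℝ≥0∞)) := measurable_of_countable _
  rw [(hL.hasLaw_count B hB hv).lintegral_comp (f := fun k : ℕ∞ => expNeg (c * k)) hm.aemeasurable,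
    lintegral_map hm (measurable_of_countable _)]
  simp only [ENat.toENNReal_coe]
  rw [lintegral_expNeg_poisson, ENNReal.coe_mul, ENNReal.coe_toNNReal hv, mul_assoc]

lemma IsHomogeneousPPP.lintegral_expNeg_sum (hL : IsHomogeneousPPP L lam μ)
    {n : ℕ} (B : Fin n → Set Plane) (hB : ∀ i, MeasurableSet (B i)) (hv : ∀ i, volume (B i) ≠ ∞)
    (hd : Pairwise fun i j => Disjoint (B i) (B j)) (c : Fin n → ℝ≥0∞) :
    ∫⁻ ω, expNeg (∑ i, c i * pointCount L (B i) ω) ∂μ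
      = expNeg (lam * ∑ i, volume (B i) * (1 - expNeg (c i))) := by
  have hm : ∀ i, Measurable fun k : ℕ∞ => expNeg (c i * (k : ℝ≥0∞)) :=
    fun i => measurable_of_countable _
  simp_rw [expNeg_sum, Finset.mul_sum]
  rw [lintegral_prod_eq_prod_lintegral_of_indepFun Finset.univ
    (fun i ω => expNeg (c i * pointCount L (B i) ω))
    ((hL.indep_count n B hB hv hd).comp (fun i k => expNeg (c i * (k : ℝ≥0∞))) hm)
    (fun i => (hm i).comp (measurable_pointCount hL.measurable (hB i))), expNeg_sum]
  exact Finset.prod_congr rfl fun i _ => hL.lintegral_expNeg_pointCount (hB i) (hv i) (c i)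

/-- The sum over the points is `∑ c · N(f = c)`, a combination of counts in disjoint sets. The value
`0` is discarded: it contributes nothing, and its level set may have infinite area. -/
lemma IsHomogeneousPPP.lintegral_expNeg_simpleFunc (hL : IsHomogeneousPPP L lam μ)
    (f : SimpleFunc Plane ℝ≥0∞) (hf : ∀ c ≠ 0, volume (f ⁻¹' {c}) ≠ ∞) :
    ∫⁻ ω, expNeg (∑' j, f (L j ω)) ∂μ = expNeg (lam * ∫⁻ x, (1 - expNeg (f x))) := by
  classical
  set s := f.range.filter (· ≠ 0) with hs
  let e := s.equivFin.symm
  have h1 : ∀ ω, ∑' j, f (L j ω)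
      = ∑ i, (e i : ℝ≥0∞) * pointCount L (f ⁻¹' {(e i : ℝ≥0∞)}) ω := fun ω => by
    have hx : Measurable fun j => L j ω := measurable_of_countable _
    -- The sum over `j` is an integral against the image of the counting measure under `j ↦ L j ω`,
    -- so the integral formula for simple functions applies.
    rw [← lintegral_count, ← lintegral_map (f := fun x => f x) f.measurable hx,
      SimpleFunc.lintegral_eq_lintegral, SimpleFunc.lintegral,
      e.sum_comp (fun c : s => (c : ℝ≥0∞) * pointCount L (f ⁻¹' {(c : ℝ≥0∞)}) ω),
      Finset.sum_coe_sort s (fun c => c * (pointCount L (f ⁻¹' {c}) ω : ℝ≥0∞)),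
      hs, Finset.sum_filter_of_ne fun c _ h => left_ne_zero_of_mul h]
    refine Finset.sum_congr rfl fun c _ => ?_
    rw [Measure.map_apply hx (f.measurableSet_preimage _),
      Measure.count_apply (hx (f.measurableSet_preimage _))]
    rfl
  have h2 : ∫⁻ x, (1 - expNeg (f x))
      = ∑ i, volume (f ⁻¹' {(e i : ℝ≥0∞)}) * (1 - expNeg (e i)) := by
    have := SimpleFunc.map_lintegral (μ := volume) (fun c => 1 - expNeg c) f
    rw [← SimpleFunc.lintegral_eq_lintegral] at this
    simp only [SimpleFunc.map_apply] at this
    rw [this, e.sum_comp (fun c : s => volume (f ⁻¹' {(c : ℝ≥0∞)}) * (1 - expNeg c)),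
      Finset.sum_coe_sort s (fun c => volume (f ⁻¹' {c}) * (1 - expNeg c)),
      hs, Finset.sum_filter_of_ne fun c _ h => ?_]
    · exact Finset.sum_congr rfl fun c _ => mul_comm _ _
    · rintro rfl
      simp at h
  simp_rw [h1, h2]
  refine hL.lintegral_expNeg_sum _ (fun i => f.measurableSet_preimage _) (fun i => hf _ ?_) ?_ _
  · exact (Finset.mem_filter.1 (e i).2).2
  · intro i j hij
    refine Disjoint.preimage _ (Set.disjoint_singleton.2 fun h => hij ?_)
    exact e.injective (Subtype.ext h)

/-- The Laplace functional of a homogeneous Poisson point process. -/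
theorem IsHomogeneousPPP.lintegral_expNeg_tsum (hL : IsHomogeneousPPP L lam μ)
    [IsProbabilityMeasure μ] {φ : Plane → ℝ≥0∞} (hφ : Measurable φ) :
    ∫⁻ ω, expNeg (∑' j, φ (L j ω)) ∂μ = expNeg (lam * ∫⁻ x, (1 - expNeg (φ x))) := by
  -- Restriction to balls gives every nonzero level set finite area while preserving monotone
  -- convergence to `φ`.
  set f : ℕ → SimpleFunc Plane ℝ≥0∞ := fun n =>
    (SimpleFunc.eapprox φ n).restrict (Metric.ball 0 n) with hf
  have hfa : ∀ n x, f n x = (Metric.ball (0 : Plane) n).indicator (SimpleFunc.eapprox φ n) x :=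
    fun n x => by rw [hf]; simp only; rw [SimpleFunc.restrict_apply _ measurableSet_ball]
  have hmono : Monotone fun n x => f n x := fun m n hmn x => by
    simp only [hfa]
    refine (Set.indicator_le_indicator_of_subset (Metric.ball_subset_ball (Nat.cast_le.2 hmn))
      (fun _ => zero_le) x).trans (Set.indicator_le_indicator ?_)
    exact SimpleFunc.monotone_eapprox φ hmn x
  have hsup : ∀ x, ⨆ n, f n x = φ x := fun x => by
    refine le_antisymm (iSup_le fun n => ?_) ?_
    · rw [hfa, ← SimpleFunc.iSup_eapprox_apply hφ x]
      exact (Set.indicator_le_self' (fun _ _ => zero_le) x).trans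
        (le_iSup (fun n => SimpleFunc.eapprox φ n x) n)
    · rw [← SimpleFunc.iSup_eapprox_apply hφ x]
      refine iSup_le fun n => ?_
      obtain ⟨k, hk⟩ := exists_nat_gt ‖x‖
      refine le_iSup_of_le (max n k) ?_
      rw [hfa, Set.indicator_of_mem]
      · exact SimpleFunc.monotone_eapprox φ (le_max_left n k) x
      · simpa using Or.inr hk
  have hfin : ∀ n, ∀ c ≠ 0, volume (f n ⁻¹' {c}) ≠ ∞ := fun n c hc => by
    refine ne_top_of_le_ne_top (measure_ball_lt_top (x := (0 : Plane)) (r := n)).ne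
      (measure_mono fun x hx => ?_)
    by_contra h
    rw [Set.mem_preimage, Set.mem_singleton_iff, hfa, Set.indicator_of_notMem h] at hx
    exact hc hx.symm
  have hlim : ∀ x, Tendsto (fun n => f n x) atTop (𝓝 (φ x)) := fun x => by
    rw [← hsup x]
    exact tendsto_atTop_iSup fun m n h => hmono h x
  have hlim' : ∀ ω, Tendsto (fun n => ∑' j, f n (L j ω)) atTop (𝓝 (∑' j, φ (L j ω))) := fun ω => by
    simp_rw [← lintegral_count]
    refine lintegral_tendsto_of_tendsto_of_monotone (fun n => (measurable_of_countable _).aemeasurable)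
      (ae_of_all _ fun j m n h => hmono h _) (ae_of_all _ fun j => hlim _)
  have h1 : Tendsto (fun n => ∫⁻ ω, expNeg (∑' j, f n (L j ω)) ∂μ) atTop
      (𝓝 (∫⁻ ω, expNeg (∑' j, φ (L j ω)) ∂μ)) := by
    refine tendsto_lintegral_of_dominated_convergence (fun _ => 1) (fun n => ?_)
      (fun n => ae_of_all _ fun ω => expNeg_le_one _) (by simp)
      (ae_of_all _ fun ω => (continuous_expNeg.tendsto _).comp (hlim' ω))
    exact measurable_expNeg.comp
      (Measurable.tsum fun j => (f n).measurable.comp (hL.measurable j))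
  have h2 : Tendsto (fun n => ∫⁻ x, (1 - expNeg (f n x))) atTop
      (𝓝 (∫⁻ x, (1 - expNeg (φ x)))) := by
    refine lintegral_tendsto_of_tendsto_of_monotone
      (fun n => (measurable_const.sub (measurable_expNeg.comp (f n).measurable)).aemeasurable)
      (ae_of_all _ fun x m n h => tsub_le_tsub_left (expNeg_antitone (hmono h x)) _)
      (ae_of_all _ fun x => ?_)
    exact ENNReal.Tendsto.sub tendsto_const_nhds ((continuous_expNeg.tendsto _).comp (hlim x))
      (Or.inl ENNReal.one_ne_top)
  simp_rw [fun n => hL.lintegral_expNeg_simpleFunc (f n) (hfin n)] at h1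
  refine tendsto_nhds_unique h1 ((continuous_expNeg.tendsto _).comp ?_)
  exact ENNReal.Tendsto.const_mul h2 (Or.inr ENNReal.coe_ne_top)

end PointProcess

/-! ### Rayleigh fading and radial integrals -/

lemma gaussianPDFReal_half_mul (r θ : ℝ) :
    gaussianPDFReal 0 (1 / 2) (r * Real.cos θ) * gaussianPDFReal 0 (1 / 2) (r * Real.sin θ)
      = Real.pi⁻¹ * Real.exp (-r ^ 2) := by
  have h : ((1 / 2 : ℝ≥0) : ℝ) = 1 / 2 := by norm_num
  have h2 : (Real.sqrt Real.pi)⁻¹ * (Real.sqrt Real.pi)⁻¹ = Real.pi⁻¹ := by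
    rw [← mul_inv, Real.mul_self_sqrt Real.pi_pos.le]
  simp only [gaussianPDFReal, h, sub_zero]
  -- Variance `1/2` turns the normalisation `√(2πσ²)` into `√π`, and the exponents add up to `-r²`
  -- independently of the angle.
  rw [show 2 * Real.pi * (1 / 2) = Real.pi by ring, mul_mul_mul_comm, h2, ← Real.exp_add]
  congr 2
  have := Real.sin_sq_add_cos_sq θ
  linear_combination (-r ^ 2) * this

/-- The modulus of a standard complex Gaussian has the Rayleigh density `2 r e^{-r²}`. -/
lemma lintegral_norm_stdComplexGaussian {f : ℝ → ℝ≥0∞} (hf : Measurable f) :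
    ∫⁻ z, f ‖z‖ ∂stdComplexGaussian
      = ∫⁻ r in Set.Ioi 0, ENNReal.ofReal (2 * r * Real.exp (-r ^ 2)) * f r := by
  have hm : Measurable fun p : ℝ × ℝ => (⟨p.1, p.2⟩ : ℂ) :=
    Complex.measurableEquivRealProd.symm.measurable
  have hg : gaussianReal 0 (1 / 2) = volume.withDensity (gaussianPDF 0 (1 / 2)) :=
    gaussianReal_of_var_ne_zero 0 (by norm_num)
  have hpm : Measurable fun z : ℝ × ℝ => gaussianPDF 0 (1 / 2) z.1 * gaussianPDF 0 (1 / 2) z.2 :=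
    ((measurable_gaussianPDF _ _).comp measurable_fst).mul
      ((measurable_gaussianPDF _ _).comp measurable_snd)
  have hfm : Measurable fun p : ℝ × ℝ => f ‖(⟨p.1, p.2⟩ : ℂ)‖ := hf.comp hm.norm
  rw [stdComplexGaussian, lintegral_map (f := fun z : ℂ => f ‖z‖) (hf.comp measurable_norm) hm, hg,
    prod_withDensity (measurable_gaussianPDF _ _) (measurable_gaussianPDF _ _),
    lintegral_withDensity_eq_lintegral_mul _ hpm hfm, ← Measure.volume_eq_prod,
    ← lintegral_comp_polarCoord_symm]
  have h1 : ∀ p ∈ polarCoord.target,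
      ENNReal.ofReal p.1 • ((fun z : ℝ × ℝ => gaussianPDF 0 (1 / 2) z.1 * gaussianPDF 0 (1 / 2) z.2) *
        fun p : ℝ × ℝ => f ‖(⟨p.1, p.2⟩ : ℂ)‖) (polarCoord.symm p)
      = (ENNReal.ofReal (p.1 * (Real.pi⁻¹ * Real.exp (-p.1 ^ 2))) * f p.1) * 1 := fun p hp => by
    have hp0 : 0 < p.1 := hp.1
    have hn : ‖(⟨p.1 * Real.cos p.2, p.1 * Real.sin p.2⟩ : ℂ)‖ = p.1 := by
      rw [Complex.norm_def, Complex.normSq_mk, show p.1 * Real.cos p.2 * (p.1 * Real.cos p.2)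
        + p.1 * Real.sin p.2 * (p.1 * Real.sin p.2)
        = p.1 ^ 2 * (Real.sin p.2 ^ 2 + Real.cos p.2 ^ 2) by ring,
        Real.sin_sq_add_cos_sq, mul_one, Real.sqrt_sq hp0.le]
    simp only [polarCoord_symm_apply, Pi.mul_apply, hn, smul_eq_mul, mul_one, gaussianPDF]
    rw [← ENNReal.ofReal_mul (gaussianPDFReal_nonneg _ _ _), gaussianPDFReal_half_mul,
      ← mul_assoc, ← ENNReal.ofReal_mul hp0.le]
  -- The angular interval contributes `2π`, which leaves the factor `2` after cancelling `π⁻¹`.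
  rw [setLIntegral_congr_fun polarCoord.open_target.measurableSet h1, polarCoord_target,
    Measure.volume_eq_prod, ← Measure.prod_restrict,
    lintegral_prod_mul (f := fun r => ENNReal.ofReal (r * (Real.pi⁻¹ * Real.exp (-r ^ 2))) * f r)
      (g := fun _ => 1) (by fun_prop) (by fun_prop), lintegral_one, Measure.restrict_apply_univ,
    Real.volume_Ioo, ← lintegral_mul_const' _ _ ENNReal.ofReal_ne_top]
  refine setLIntegral_congr_fun measurableSet_Ioi fun r hr => ?_
  have hr0 : 0 < r := hr
  rw [mul_right_comm, ← ENNReal.ofReal_mul (by positivity)]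
  congr 2
  field_simp
  ring

/-- The squared modulus is exponential with mean one. -/
lemma lintegral_exp_neg_mul_norm_sq {c : ℝ} (hc : 0 ≤ c) :
    ∫⁻ z, expNeg (ENNReal.ofReal (c * ‖z‖ ^ 2)) ∂stdComplexGaussian
      = ENNReal.ofReal (1 / (1 + c)) := by
  have hc1 : 0 < 1 + c := by linarith
  rw [lintegral_norm_stdComplexGaussian (f := fun r => expNeg (ENNReal.ofReal (c * r ^ 2)))
    (measurable_expNeg.comp (by fun_prop))]
  have h1 : ∀ r ∈ Set.Ioi (0 : ℝ), ENNReal.ofReal (2 * r * Real.exp (-r ^ 2)) *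
      expNeg (ENNReal.ofReal (c * r ^ 2))
      = ENNReal.ofReal (2 * (r ^ (1 : ℝ) * Real.exp (-(1 + c) * r ^ (2 : ℝ)))) := fun r hr => by
    have hr0 : 0 < r := hr
    rw [expNeg_ofReal (by positivity), ← ENNReal.ofReal_mul (by positivity), mul_assoc,
      ← Real.exp_add, Real.rpow_one, Real.rpow_two, mul_assoc]
    ring_nf
  rw [setLIntegral_congr_fun measurableSet_Ioi h1, ← ofReal_integral_eq_lintegral_ofReal]
  · rw [integral_const_mul, integral_rpow_mul_exp_neg_mul_rpow (by norm_num) (by norm_num) hc1]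
    rw [show -((1 : ℝ) + 1) / 2 = -1 by norm_num, show ((1 : ℝ) + 1) / 2 = 1 by norm_num,
      Real.rpow_neg_one, Real.Gamma_one]
    congr 1
    field_simp
  · exact (integrableOn_rpow_mul_exp_neg_mul_rpow (by norm_num) (by norm_num) hc1).const_mul 2
  · refine (ae_restrict_iff' measurableSet_Ioi).2 (ae_of_all _ fun r hr => ?_)
    have hr0 : 0 < r := hr
    positivity

lemma lintegral_exp_neg_mul_norm_rpow {α u : ℝ} (hα : 0 < α) (hu : 0 < u) :
    ∫⁻ x : Plane, ENNReal.ofReal (Real.exp (-(u * ‖x‖ ^ α)))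
      = ENNReal.ofReal (Real.pi * Real.Gamma (2 / α + 1) * u ^ (-(2 / α))) := by
  have hd : Module.finrank ℝ Plane = 2 := by simp
  have hball : (volume (Metric.ball (0 : Plane) 1)).toReal = Real.pi := by
    simp [Real.pi_pos.le]
  have hi : Integrable fun x : Plane => Real.exp (-(u * ‖x‖ ^ α)) := by
    rw [integrable_fun_norm_addHaar volume (f := fun r => Real.exp (-(u * r ^ α))), hd]
    have := integrableOn_rpow_mul_exp_neg_mul_rpow (s := 1) (p := α) (b := u) (by norm_num) hα hu
    simpa using this
  rw [← ofReal_integral_eq_lintegral_ofReal hi (ae_of_all _ fun x => (Real.exp_pos _).le),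
    integral_fun_norm_addHaar volume (fun r => Real.exp (-(u * r ^ α))), hd, measureReal_def, hball]
  have := integral_rpow_mul_exp_neg_mul_rpow (p := α) (q := 1) (b := u) hα (by norm_num) hu
  have h2 : ∫ y in Set.Ioi (0 : ℝ), y ^ (2 - 1) • Real.exp (-(u * y ^ α))
      = u ^ (-(2 / α)) * (1 / α) * Real.Gamma (2 / α) := by
    rw [show -(2 / α) = -((1 : ℝ) + 1) / α by ring, show 2 / α = ((1 : ℝ) + 1) / α by ring, ← this]
    simp
  rw [h2, Real.Gamma_add_one (by positivity)]
  congr 1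
  simp only [nsmul_eq_mul, smul_eq_mul, Nat.cast_ofNat]
  field_simp

/-- The plane integral of `c / (‖x‖ ^ α + c)`. -/
lemma lintegral_div_norm_rpow_add {α c : ℝ} (hα : 2 < α) (hc : 0 < c) :
    ∫⁻ x : Plane, ENNReal.ofReal (c / (‖x‖ ^ α + c))
      = ENNReal.ofReal (kappa (2 / α) * c ^ (2 / α)) := by
  have hδ : 2 / α < 1 := (div_lt_one (by linarith)).2 hα
  -- Writing the reciprocal as `∫ e^{-u(‖x‖^α + c)} du` separates the variables. The plane integral
  -- gives `π Γ(1+δ) u^{-δ}`, and the integral over `u` then gives `Γ(1-δ)`; it converges at `0`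
  -- because `δ < 1`.
  have h1 : ∀ x : Plane, ENNReal.ofReal (c / (‖x‖ ^ α + c))
      = ∫⁻ u in Set.Ioi (0 : ℝ), ENNReal.ofReal (c * Real.exp (-(u * c)))
        * ENNReal.ofReal (Real.exp (-(u * ‖x‖ ^ α))) := fun x => by
    have hp : 0 < ‖x‖ ^ α + c := by positivity
    have h := integral_exp_mul_Ioi (neg_lt_zero.2 hp) 0
    have hi := integrableOn_exp_mul_Ioi (neg_lt_zero.2 hp) 0
    calc _ = ENNReal.ofReal (∫ u in Set.Ioi (0 : ℝ), c * Real.exp (-(‖x‖ ^ α + c) * u)) := by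
          rw [integral_const_mul, h]; congr 1
          rw [mul_zero, Real.exp_zero, neg_div_neg_eq, mul_one_div]
      _ = _ := by
          rw [ofReal_integral_eq_lintegral_ofReal (hi.const_mul c) (ae_of_all _ fun u => by
            simp only [Pi.zero_apply]; positivity)]
          refine lintegral_congr fun u => ?_
          rw [← ENNReal.ofReal_mul (by positivity), mul_assoc, ← Real.exp_add]
          ring_nf
  simp_rw [h1]
  rw [lintegral_lintegral_swap (by fun_prop)]
  have h2 : ∀ u ∈ Set.Ioi (0 : ℝ), ∫⁻ x : Plane, ENNReal.ofReal (c * Real.exp (-(u * c)))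
        * ENNReal.ofReal (Real.exp (-(u * ‖x‖ ^ α)))
      = ENNReal.ofReal (c * Real.pi * Real.Gamma (2 / α + 1) *
        (u ^ ((1 - 2 / α) - 1) * Real.exp (-(c * u)))) := fun u hu => by
    rw [lintegral_const_mul' _ _ ENNReal.ofReal_ne_top,
      lintegral_exp_neg_mul_norm_rpow (by linarith) hu, ← ENNReal.ofReal_mul (by positivity)]
    congr 1
    rw [show (1 - 2 / α) - 1 = -(2 / α) by ring, mul_comm u c]
    ring
  have hi : IntegrableOn (fun u : ℝ => u ^ ((1 - 2 / α) - 1) * Real.exp (-(c * u))) (Set.Ioi 0) := by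
    have := integrableOn_rpow_mul_exp_neg_mul_rpow (s := 1 - 2 / α - 1) (p := 1) (b := c)
      (by linarith) one_pos hc
    simpa using this
  have hG : 0 < Real.Gamma (2 / α + 1) := Real.Gamma_pos_of_pos (by positivity)
  rw [setLIntegral_congr_fun measurableSet_Ioi h2, ← ofReal_integral_eq_lintegral_ofReal
    (hi.const_mul _)]
  · rw [integral_const_mul, Real.integral_rpow_mul_exp_neg_mul_Ioi (by linarith) hc, kappa]
    congr 1
    rw [one_div, Real.inv_rpow hc.le, ← Real.rpow_neg hc.le, show c ^ (2 / α) = c * c ^ (-(1 - 2 / α)) by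
      rw [← Real.rpow_one_add' hc.le] <;> ring_nf; positivity, add_comm]
    ring
  · refine (ae_restrict_iff' measurableSet_Ioi).2 (ae_of_all _ fun r hr => ?_)
    have hr0 : 0 < r := hr
    simp only [Pi.zero_apply]
    positivity

/-! ### The coefficients `Υ` and the derivatives of `e^{-K s^δ}` -/

lemma upsilon_zero_zero (δ : ℝ) : upsilon δ 0 0 = 1 := by simp [upsilon]

lemma upsilon_self (δ : ℝ) (m : ℕ) : upsilon δ m m = 1 := by simp [upsilon]

lemma upsilon_zero_right (δ : ℝ) {m : ℕ} (hm : 1 ≤ m) : upsilon δ m 0 = 0 := by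
  rw [upsilon, Finset.powersetCard_eq_empty.2, Finset.sum_empty]
  simp; omega

lemma rankIn_insert_of_lt {s : Finset ℕ} {l m : ℕ} (h : l < m) :
    rankIn (insert m s) l = rankIn s l := by
  rw [rankIn, rankIn, Finset.filter_insert, if_neg (by omega)]

lemma rankIn_eq_card {s : Finset ℕ} {m : ℕ} (h : ∀ l ∈ s, l ≤ m) : rankIn s m = s.card := by
  rw [rankIn, Finset.filter_true_of_mem h]

/-- Split the subsets of `{1,…,m}` of size `m - i` by whether they contain `m`. If so, `m` has rank
`m - i`, hence its factor is `m - δ(i+1)`, and the ranks of the other elements are unchanged. The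
remaining subsets give `Υ_{m,i}`. -/
lemma upsilon_succ_succ (δ : ℝ) {m i : ℕ} (h : i + 1 ≤ m) :
    upsilon δ (m + 1) (i + 1) = (m - δ * (i + 1)) * upsilon δ m (i + 1) + upsilon δ m i := by
  obtain ⟨k, rfl⟩ : ∃ k, m = k + 1 := ⟨m - 1, by omega⟩
  have hI : Finset.Icc 1 (k + 1) = insert (k + 1) (Finset.Icc 1 k) := by
    ext i; simp; omega
  have hnot : k + 1 ∉ Finset.Icc 1 k := by simp
  obtain ⟨d, hd⟩ : ∃ d, k + 1 = d + (i + 1) := ⟨k - i, by omega⟩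
  unfold upsilon
  rw [show k + 1 + 1 - 1 = k + 1 by omega, show k + 1 - 1 = k by omega,
    show k + 1 + 1 - (i + 1) = d + 1 by omega, show k + 1 - (i + 1) = d by omega,
    show k + 1 - i = d + 1 by omega, hI, Finset.powersetCard_succ_insert hnot,
    Finset.sum_union, add_comm]
  · congr 1
    rw [Finset.sum_image, Finset.mul_sum]
    · refine Finset.sum_congr rfl fun s hs => ?_
      obtain ⟨hsub, hcard⟩ := Finset.mem_powersetCard.1 hs
      have hle : ∀ l ∈ s, l < k + 1 := fun l hl => by
        have := Finset.mem_Icc.1 (hsub hl); omega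
      have hns : k + 1 ∉ s := fun h => (hle _ h).false
      rw [Finset.prod_insert hns, rankIn_eq_card, Finset.card_insert_of_notMem hns, hcard]
      · congr 1
        · have : ((k + 1 : ℕ) : ℝ) = d + (i + 1) := by rw [hd]; push_cast; ring
          rw [this]; push_cast; ring
        · exact Finset.prod_congr rfl fun l hl => by rw [rankIn_insert_of_lt (hle l hl)]
      · intro l hl
        rcases Finset.mem_insert.1 hl with rfl | hl
        · exact le_rfl
        · exact (hle l hl).le
    · intro s hs t ht hst
      have h1 : k + 1 ∉ s := fun h => hnot ((Finset.mem_powersetCard.1 hs).1 h)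
      have h2 : k + 1 ∉ t := fun h => hnot ((Finset.mem_powersetCard.1 ht).1 h)
      rw [← Finset.erase_insert h1, ← Finset.erase_insert h2, hst]
  · rw [Finset.disjoint_left]
    intro s hs ht
    obtain ⟨t, -, rfl⟩ := Finset.mem_image.1 ht
    exact hnot ((Finset.mem_powersetCard.1 hs).1 (Finset.mem_insert_self _ _))

/-- The candidate for `(-1)^n` times the `n`-th derivative of `s ↦ e^{-K s^δ}`. -/
def laplaceDeriv (K δ : ℝ) (n : ℕ) (s : ℝ) : ℝ :=
  ∑ i ∈ Finset.range (n + 1),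
    upsilon δ n i * ((δ * K) ^ i * (s ^ (δ * i - n) * Real.exp (-(K * s ^ δ))))

lemma laplaceDeriv_zero (K δ s : ℝ) : laplaceDeriv K δ 0 s = Real.exp (-(K * s ^ δ)) := by
  simp [laplaceDeriv, upsilon_zero_zero]

/-- The right side is minus the termwise derivative. Differentiating the power keeps `i` and brings
out `n - δi`; differentiating the exponential raises `i` by one. Collecting powers gives the
recurrence for `Υ`. -/
lemma laplaceDeriv_succ (K δ : ℝ) (n : ℕ) {s : ℝ} (hs : 0 < s) :
    laplaceDeriv K δ (n + 1) s = ∑ i ∈ Finset.range (n + 1),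
      upsilon δ n i * ((δ * K) ^ i * (-((δ * i - n) * s ^ (δ * i - n - 1)
        - δ * K * s ^ (δ - 1) * s ^ (δ * i - n)) * Real.exp (-(K * s ^ δ)))) := by
  have h1 : ∀ i : ℕ, s ^ (δ - 1) * s ^ (δ * i - n) = s ^ (δ * ((i + 1 : ℕ) : ℝ) - ((n + 1 : ℕ) : ℝ)) := fun i => by
    rw [← Real.rpow_add hs]; push_cast; congr 1; ring
  have h2 : ∀ i : ℕ, s ^ (δ * i - n - 1) = s ^ (δ * i - ((n + 1 : ℕ) : ℝ)) := fun i => by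
    push_cast; congr 1; ring
  have h3 : ∀ i ∈ Finset.range (n + 1),
      upsilon δ n i * ((δ * K) ^ i * (-((δ * i - n) * s ^ (δ * i - n - 1)
        - δ * K * s ^ (δ - 1) * s ^ (δ * i - n)) * Real.exp (-(K * s ^ δ))))
      = (n - δ * i) * upsilon δ n i * ((δ * K) ^ i * (s ^ (δ * i - ((n + 1 : ℕ) : ℝ))
          * Real.exp (-(K * s ^ δ))))
        + upsilon δ n i * ((δ * K) ^ (i + 1) * (s ^ (δ * ((i + 1 : ℕ) : ℝ) - ((n + 1 : ℕ) : ℝ))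
          * Real.exp (-(K * s ^ δ)))) := fun i _ => by
    rw [h2, mul_assoc (δ * K), h1]; ring
  rw [Finset.sum_congr rfl h3, Finset.sum_add_distrib, laplaceDeriv]
  -- The case `n = 0` is separate because `Υ_{0,0} = 1`, whereas `Υ_{n,0} = 0` for `n ≥ 1`.
  rcases Nat.eq_zero_or_pos n with rfl | hn
  · simp [Finset.sum_range_succ, upsilon_self, upsilon_zero_right]
  · rw [Finset.sum_range_succ', Finset.sum_range_succ, Finset.sum_range_succ' _ n,
      Finset.sum_range_succ (fun i => upsilon δ n i * _) n,
      upsilon_zero_right δ (by omega), upsilon_zero_right δ hn, upsilon_self, upsilon_self]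
    have h4 : ∀ i ∈ Finset.range n, upsilon δ (n + 1) (i + 1)
        = (n - δ * ((i + 1 : ℕ) : ℝ)) * upsilon δ n (i + 1) + upsilon δ n i := fun i hi => by
      rw [upsilon_succ_succ δ (by simpa using Finset.mem_range.1 hi)]; push_cast; ring
    rw [Finset.sum_congr rfl fun i hi => by rw [h4 i hi, add_mul], Finset.sum_add_distrib]
    ring

lemma hasDerivAt_laplaceDeriv (K δ : ℝ) (n : ℕ) {s : ℝ} (hs : 0 < s) :
    HasDerivAt (laplaceDeriv K δ n) (-laplaceDeriv K δ (n + 1) s) s := by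
  rw [laplaceDeriv_succ K δ n hs, ← Finset.sum_neg_distrib]
  unfold laplaceDeriv
  refine HasDerivAt.fun_sum fun i _ => ?_
  have h1 := Real.hasDerivAt_rpow_const (x := s) (p := δ * i - n) (Or.inl hs.ne')
  have h2 := ((Real.hasDerivAt_rpow_const (x := s) (p := δ) (Or.inl hs.ne')).const_mul K).fun_neg.exp
  refine (((h1.fun_mul h2).const_mul ((δ * K) ^ i)).const_mul (upsilon δ n i)).congr_deriv ?_
  ring

/-- Multiplying by `s ^ n` turns `laplaceDeriv` into the polynomial expression in `K s^δ`. -/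
lemma pow_mul_laplaceDeriv (K δ : ℝ) {n : ℕ} (hn : 1 ≤ n) {s : ℝ} (hs : 0 < s) :
    s ^ n * laplaceDeriv K δ n s
      = Real.exp (-(K * s ^ δ)) * ∑ i ∈ Finset.Icc 1 n, (δ * (K * s ^ δ)) ^ i * upsilon δ n i := by
  have hI : Finset.range (n + 1) = insert 0 (Finset.Icc 1 n) := by
    ext i; simp; omega
  rw [laplaceDeriv, hI, Finset.sum_insert (by simp), upsilon_zero_right δ hn, zero_mul, zero_add,
    Finset.mul_sum, Finset.mul_sum]
  refine Finset.sum_congr rfl fun i _ => ?_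
  rw [Real.rpow_sub hs, Real.rpow_natCast, Real.rpow_mul hs.le, Real.rpow_natCast]
  field_simp
  rw [mul_pow (δ * K)]
  ring

/-! ### Laplace transform and moments of the interference -/

section Interference

variable {Ω : Type*} [MeasurableSpace Ω] {μ : Measure Ω}

/-- For independent `X` and `Y`, the expectation of `F (X, Y)` is an iterated expectation. -/
lemma lintegral_comp_pair_of_indepFun {β γ : Type*} [MeasurableSpace β] [MeasurableSpace γ]
    [IsFiniteMeasure μ] {X : Ω → β} {Y : Ω → γ} (hX : Measurable X) (hY : Measurable Y)
    (h : IndepFun X Y μ) {F : β × γ → ℝ≥0∞} (hF : Measurable F) :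
    ∫⁻ ω, F (X ω, Y ω) ∂μ = ∫⁻ ω', ∫⁻ ω, F (X ω, Y ω') ∂μ ∂μ := by
  have hp := (indepFun_iff_map_prod_eq_prod_map_map hX.aemeasurable hY.aemeasurable).1 h
  rw [← lintegral_map (f := F) hF (hX.prodMk hY), hp, lintegral_prod_symm _ hF.aemeasurable,
    lintegral_map (hF.lintegral_prod_left') hY]
  exact lintegral_congr fun ω' => lintegral_map (hF.comp measurable_prodMk_right) hX

variable {L : ℕ → Ω → Plane} {lam : ℝ≥0} {h : ℕ → Ω → ℂ} {α PJ : ℝ}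

lemma measurable_interferencePower (hL : ∀ j, Measurable (L j)) (hh : ∀ j, Measurable (h j)) :
    Measurable (interferencePower α PJ L h) := by
  unfold interferencePower
  refine Measurable.tsum fun j => ?_
  have := hL j
  have := hh j
  fun_prop

/-- The conditional Laplace transform of finitely many interference terms given the locations. -/
lemma lintegral_expNeg_sum_fading [IsProbabilityMeasure μ] (hh : ∀ j, Measurable (h j))
    (hlaw : ∀ j, HasLaw (h j) stdComplexGaussian μ) (hind : iIndepFun h μ) (n : ℕ)
    {c : ℕ → ℝ} (hc : ∀ j, 0 ≤ c j) :
    ∫⁻ ω, expNeg (∑ j ∈ Finset.range n, ENNReal.ofReal (c j * ‖h j ω‖ ^ 2)) ∂μ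
      = expNeg (∑ j ∈ Finset.range n, ENNReal.ofReal (Real.log (1 + c j))) := by
  have hm : ∀ j, Measurable fun z : ℂ => expNeg (ENNReal.ofReal (c j * ‖z‖ ^ 2)) :=
    fun j => measurable_expNeg.comp (by fun_prop)
  simp_rw [expNeg_sum]
  rw [lintegral_prod_eq_prod_lintegral_of_indepFun _
    (fun j ω => expNeg (ENNReal.ofReal (c j * ‖h j ω‖ ^ 2)))
    (hind.comp (fun j z => expNeg (ENNReal.ofReal (c j * ‖z‖ ^ 2))) hm)
    (fun j => (hm j).comp (hh j))]
  refine Finset.prod_congr rfl fun j _ => ?_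
  have h1 : 0 < 1 + c j := by linarith [hc j]
  rw [(hlaw j).lintegral_comp (hm j).aemeasurable, lintegral_exp_neg_mul_norm_sq (hc j),
    expNeg_ofReal (Real.log_nonneg (by linarith [hc j])), Real.exp_neg, Real.exp_log h1, one_div]

/-- The Laplace transform of the aggregate interference. -/
theorem lintegral_expNeg_interferencePower [IsProbabilityMeasure μ] (hL : IsHomogeneousPPP L lam μ)
    (hh : ∀ j, Measurable (h j)) (hlaw : ∀ j, HasLaw (h j) stdComplexGaussian μ)
    (hind : iIndepFun h μ) (hLh : IndepFun (fun ω j => h j ω) (fun ω j => L j ω) μ)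
    (hα : 2 < α) (hPJ : 0 < PJ) {s : ℝ} (hs : 0 < s) :
    ∫⁻ ω, expNeg (ENNReal.ofReal s * interferencePower α PJ L h ω) ∂μ
      = ENNReal.ofReal (Real.exp (-(lam * kappa (2 / α) * PJ ^ (2 / α) * s ^ (2 / α)))) := by
  have hLm := hL.measurable
  set c : Plane → ℝ := fun x => s * PJ * ‖x‖ ^ (-α) with hc
  have hc0 : ∀ x, 0 ≤ c x := fun x => by positivity
  have hcm : Measurable c := by fun_prop
  have hterm : ∀ ω, ENNReal.ofReal s * interferencePower α PJ L h ω
      = ∑' j, ENNReal.ofReal (c (L j ω) * ‖h j ω‖ ^ 2) := fun ω => by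
    rw [interferencePower, ← ENNReal.tsum_mul_left]
    refine tsum_congr fun j => ?_
    rw [← ENNReal.ofReal_mul hs.le, hc]
    congr 1; ring
  -- Averaging over the fading replaces `c‖h‖²` by `log (1 + c)`, since `1/(1+c) = e^{-log(1+c)}`.
  -- Keeping it in exponential form lets the Laplace functional apply to the locations. Finite sums
  -- come first, and the limit is dominated by `1`.
  have hfin : ∀ n, ∫⁻ ω, expNeg (∑ j ∈ Finset.range n, ENNReal.ofReal (c (L j ω) * ‖h j ω‖ ^ 2)) ∂μ
      = ∫⁻ ω, expNeg (∑ j ∈ Finset.range n, ENNReal.ofReal (Real.log (1 + c (L j ω)))) ∂μ := by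
    intro n
    rw [lintegral_comp_pair_of_indepFun (measurable_pi_lambda _ hh) (measurable_pi_lambda _ hLm) hLh
      (F := fun p : (ℕ → ℂ) × (ℕ → Plane) =>
        expNeg (∑ j ∈ Finset.range n, ENNReal.ofReal (c (p.2 j) * ‖p.1 j‖ ^ 2)))
      (measurable_expNeg.comp (by fun_prop))]
    exact lintegral_congr fun ω' => lintegral_expNeg_sum_fading hh hlaw hind n fun j => hc0 _
  have hlim : ∀ f : ℕ → Ω → ℝ≥0∞, (∀ j, Measurable (f j)) →
      Tendsto (fun n => ∫⁻ ω, expNeg (∑ j ∈ Finset.range n, f j ω) ∂μ) atTop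
        (𝓝 (∫⁻ ω, expNeg (∑' j, f j ω) ∂μ)) := fun f hf => by
    refine tendsto_lintegral_of_dominated_convergence (fun _ => 1)
      (fun n => measurable_expNeg.comp (Finset.measurable_sum _ fun j _ => hf j))
      (fun n => ae_of_all _ fun ω => expNeg_le_one _) (by simp) (ae_of_all _ fun ω => ?_)
    exact (continuous_expNeg.tendsto _).comp (ENNReal.tendsto_nat_tsum _)
  have hφm : Measurable fun x => ENNReal.ofReal (Real.log (1 + c x)) := by fun_prop
  have heq : ∫⁻ ω, expNeg (∑' j, ENNReal.ofReal (c (L j ω) * ‖h j ω‖ ^ 2)) ∂μ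
      = ∫⁻ ω, expNeg (∑' j, ENNReal.ofReal (Real.log (1 + c (L j ω)))) ∂μ := by
    refine tendsto_nhds_unique (hlim _ fun j => ?_) ?_
    · have := hLm j
      have := hh j
      fun_prop
    · simp_rw [hfin]
      exact hlim _ fun j => hφm.comp (hLm j)
  simp_rw [hterm]
  rw [heq, hL.lintegral_expNeg_tsum hφm]
  have hint : ∫⁻ x : Plane, (1 - expNeg (ENNReal.ofReal (Real.log (1 + c x))))
      = ∫⁻ x : Plane, ENNReal.ofReal (s * PJ / (‖x‖ ^ α + s * PJ)) := by
    -- At the origin `‖0‖ ^ (-α) = 0`, so there the two integrands take the values `0` and `1`.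
    have hne : ∀ᵐ x : Plane, x ≠ 0 := by
      simp [ae_iff]
    refine lintegral_congr_ae (hne.mono fun x hx => ?_)
    have hx0 : 0 < ‖x‖ ^ α := Real.rpow_pos_of_pos (norm_pos_iff.2 hx) _
    have h1 : 0 < 1 + c x := by linarith [hc0 x]
    have hsP : 0 < s * PJ := by positivity
    simp only
    rw [expNeg_ofReal (Real.log_nonneg (by linarith [hc0 x])), Real.exp_neg, Real.exp_log h1,
      ← ENNReal.ofReal_one, ← ENNReal.ofReal_sub _ (by positivity)]
    congr 1
    simp only [hc] at h1 ⊢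
    rw [Real.rpow_neg (norm_nonneg x)] at h1 ⊢
    have h2 : 0 < ‖x‖ ^ α + s * PJ := by positivity
    field_simp
    ring
  have hk : 0 ≤ kappa (2 / α) := by
    have : 2 / α < 1 := (div_lt_one (by linarith)).2 hα
    have h2 : 0 < 2 / α := by positivity
    have := Real.Gamma_pos_of_pos (show 0 < 1 + 2 / α by linarith)
    have := Real.Gamma_pos_of_pos (show 0 < 1 - 2 / α by linarith)
    unfold kappa
    positivity
  rw [hint, lintegral_div_norm_rpow_add hα (by positivity), ← ENNReal.ofReal_coe_nnreal,
    ← ENNReal.ofReal_mul lam.coe_nonneg, expNeg_ofReal (by positivity), Real.mul_rpow hs.le hPJ.le]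
  congr 3
  ring

variable {I : Ω → ℝ≥0∞} {K δ : ℝ}

/-- Since `e^{-sI}` vanishes on `I = ∞`, its mean is at most `P(I < ∞)`; let `s → 0`. -/
lemma ae_lt_top_of_laplace [IsProbabilityMeasure μ] (hI : Measurable I) (hδ : 0 < δ)
    (hlap : ∀ s : ℝ, 0 < s →
      ∫⁻ ω, expNeg (ENNReal.ofReal s * I ω) ∂μ = ENNReal.ofReal (Real.exp (-(K * s ^ δ)))) :
    ∀ᵐ ω ∂μ, I ω < ∞ := by
  have hms : MeasurableSet {ω | I ω < ∞} := measurableSet_lt hI measurable_const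
  change {ω | I ω < ∞} ∈ ae μ
  rw [mem_ae_iff_prob_eq_one hms]
  refine le_antisymm prob_le_one ?_
  have hb : ∀ s : ℝ, 0 < s → ENNReal.ofReal (Real.exp (-(K * s ^ δ))) ≤ μ {ω | I ω < ∞} := by
    intro s hs
    rw [← hlap s hs, ← lintegral_indicator_one hms]
    refine lintegral_mono fun ω => ?_
    by_cases h : I ω < ∞
    · rw [Set.indicator_of_mem (show ω ∈ {ω | I ω < ∞} from h)]; exact expNeg_le_one _
    · rw [not_lt_top_iff.1 h, ENNReal.mul_top (by simpa using hs), expNeg_top]; exact zero_le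
  have hcont : ContinuousAt (fun s : ℝ => ENNReal.ofReal (Real.exp (-(K * s ^ δ)))) 0 := by
    refine ENNReal.continuous_ofReal.continuousAt.comp ?_
    have := Real.continuousAt_rpow_const 0 δ (Or.inr hδ.le)
    fun_prop
  have hlim : Tendsto (fun s : ℝ => ENNReal.ofReal (Real.exp (-(K * s ^ δ)))) (𝓝[>] 0) (𝓝 1) := by
    have := hcont.tendsto.mono_left (nhdsWithin_le_nhds (s := Set.Ioi 0))
    simpa [Real.zero_rpow hδ.ne'] using this
  exact le_of_tendsto hlim (eventually_nhdsWithin_of_forall fun s hs => hb s hs)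

/-- Since `e^{-sI} = 1` on `I = 0`, its mean is at least `P(I = 0)`; let `s → ∞`. -/
lemma ae_ne_zero_of_laplace (hI : Measurable I) (hδ : 0 < δ) (hK : 0 < K)
    (hlap : ∀ s : ℝ, 0 < s →
      ∫⁻ ω, expNeg (ENNReal.ofReal s * I ω) ∂μ = ENNReal.ofReal (Real.exp (-(K * s ^ δ)))) :
    ∀ᵐ ω ∂μ, I ω ≠ 0 := by
  have hms : MeasurableSet {ω | I ω = 0} := hI (measurableSet_singleton 0)
  have hb : ∀ s : ℝ, 0 < s → μ {ω | I ω = 0} ≤ ENNReal.ofReal (Real.exp (-(K * s ^ δ))) := by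
    intro s hs
    rw [← hlap s hs, ← lintegral_indicator_one hms]
    refine lintegral_mono fun ω => ?_
    by_cases h : I ω = 0
    · rw [h, mul_zero, expNeg_zero]
      exact Set.indicator_le_self' (fun _ _ => zero_le) ω
    · rw [Set.indicator_of_notMem (show ω ∉ {ω | I ω = 0} from h)]; exact zero_le
  have hlim : Tendsto (fun s : ℝ => ENNReal.ofReal (Real.exp (-(K * s ^ δ)))) atTop (𝓝 0) := by
    rw [← ENNReal.ofReal_zero]
    refine (ENNReal.continuous_ofReal.tendsto 0).comp (Real.tendsto_exp_neg_atTop_nhds_zero.comp ?_)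
    exact (tendsto_rpow_atTop hδ).const_mul_atTop hK
  rw [ae_iff]
  simp only [ne_eq, not_not]
  exact nonpos_iff_eq_zero.1 (ge_of_tendsto hlim ((eventually_gt_atTop 0).mono hb))

/-- Exponentially damped moments are the derivatives of the Laplace transform. -/
lemma integral_pow_mul_exp_neg_of_laplace [IsProbabilityMeasure μ] (hI : Measurable I) (hδ : 0 < δ)
    (hlap : ∀ s : ℝ, 0 < s →
      ∫⁻ ω, expNeg (ENNReal.ofReal s * I ω) ∂μ = ENNReal.ofReal (Real.exp (-(K * s ^ δ))))
    (n : ℕ) {s : ℝ} (hs : 0 < s) :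
    Integrable (fun ω => (I ω).toReal ^ n * Real.exp (-(s * (I ω).toReal))) μ ∧
      ∫ ω, (I ω).toReal ^ n * Real.exp (-(s * (I ω).toReal)) ∂μ = laplaceDeriv K δ n s := by
  set X : Ω → ℝ := fun ω => (I ω).toReal with hX
  have hXm : Measurable X := hI.ennreal_toReal
  have hX0 : ∀ ω, 0 ≤ X ω := fun ω => ENNReal.toReal_nonneg
  have hint : ∀ t < 0, Integrable (fun ω => Real.exp (t * X ω)) μ := fun t ht => by
    refine Integrable.of_bound (by fun_prop) 1 (ae_of_all _ fun ω => ?_)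
    rw [Real.norm_eq_abs, Real.abs_exp, Real.exp_le_one_iff]
    exact mul_nonpos_of_nonpos_of_nonneg ht.le (hX0 ω)
  -- Every negative `t` is interior to the domain of the moment generating function, which allows
  -- differentiation under the expectation at `t = -s`.
  have hmem : ∀ t < 0, t ∈ interior (integrableExpSet X μ) := fun t ht =>
    interior_maximal (fun u (hu : u < 0) => hint u hu) isOpen_Iio ht
  have hmgf : ∀ t < 0, mgf X μ t = Real.exp (-(K * (-t) ^ δ)) := fun t ht => by
    have hae := ae_lt_top_of_laplace hI hδ hlap
    rw [mgf, integral_eq_lintegral_of_nonneg_ae (ae_of_all _ fun ω => (Real.exp_pos _).le)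
      (by fun_prop), ← ENNReal.toReal_ofReal (Real.exp_pos (-(K * (-t) ^ δ))).le,
      ← hlap (-t) (by linarith)]
    congr 1
    refine lintegral_congr_ae (hae.mono fun ω hω => ?_)
    simp only
    rw [expNeg_of_ne_top (ENNReal.mul_ne_top ENNReal.ofReal_ne_top hω.ne), ENNReal.toReal_mul,
      ENNReal.toReal_ofReal (by linarith)]
    congr 2
    simp [hX]
  have hder : ∀ n, ∀ t < 0, iteratedDeriv n (mgf X μ) t = laplaceDeriv K δ n (-t) := by
    intro n
    induction n with
    | zero => intro t ht; rw [iteratedDeriv_zero, laplaceDeriv_zero, hmgf t ht]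
    | succ n ih =>
      intro t ht
      rw [iteratedDeriv_succ]
      have hev : iteratedDeriv n (mgf X μ) =ᶠ[𝓝 t] fun t => laplaceDeriv K δ n (-t) :=
        Filter.eventuallyEq_of_mem (Iio_mem_nhds ht) fun u hu => ih u hu
      have hd := (hasDerivAt_laplaceDeriv K δ n (neg_pos.2 ht)).scomp t (hasDerivAt_neg t)
      rw [hev.deriv_eq]
      have := hd.deriv
      simp only [neg_smul, one_smul, neg_neg] at this
      exact this
  constructor
  · have := integrable_pow_mul_exp_of_mem_interior_integrableExpSet (hmem (-s) (by linarith)) n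
    simpa using this
  · have := hder n (-s) (by linarith)
    rw [iteratedDeriv_mgf (hmem (-s) (by linarith)), neg_neg] at this
    rw [← this]
    simp [hX]

end Interference

/-! ### Distribution of the signal power -/

/-- The modulus of a complex Gaussian of variance `k²` has the density `2 v k⁻² e^{-v²/k²}`. -/
lemma lintegral_const_mul_norm_stdComplexGaussian {k : ℝ} (hk : 0 < k) {f : ℝ → ℝ≥0∞}
    (hf : Measurable f) :
    ∫⁻ z, f (k * ‖z‖) ∂stdComplexGaussian
      = ∫⁻ v in Set.Ioi 0, ENNReal.ofReal (2 * v / k ^ 2 * Real.exp (-(v ^ 2 / k ^ 2))) * f v := by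
  rw [lintegral_norm_stdComplexGaussian (f := fun r => f (k * r)) (by fun_prop),
    ← lintegral_indicator measurableSet_Ioi, ← lintegral_indicator measurableSet_Ioi]
  have hm : Measurable ((Set.Ioi (0 : ℝ)).indicator
      fun v => ENNReal.ofReal (2 * v / k ^ 2 * Real.exp (-(v ^ 2 / k ^ 2))) * f v) :=
    Measurable.indicator (by fun_prop) measurableSet_Ioi
  conv_rhs => rw [← Real.smul_map_volume_mul_left hk.ne', lintegral_smul_measure,
    lintegral_map hm (measurable_const_mul k), abs_of_pos hk, smul_eq_mul,
    ← lintegral_const_mul' _ _ ENNReal.ofReal_ne_top]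
  refine lintegral_congr fun r => ?_
  by_cases hr : 0 < r
  · have hkr : 0 < k * r := mul_pos hk hr
    rw [Set.indicator_of_mem (Set.mem_Ioi.2 hr), Set.indicator_of_mem (Set.mem_Ioi.2 hkr),
      ← mul_assoc, ← ENNReal.ofReal_mul hk.le]
    congr 2
    field_simp
  · have hkr : ¬ 0 < k * r := fun h => hr (pos_of_mul_pos_right h hk.le)
    rw [Set.indicator_of_notMem (by simpa using hr), Set.indicator_of_notMem (by simpa using hkr),
      mul_zero]

/-- A product of absolutely continuous laws has the product density. -/
lemma pi_withDensity_ofReal {ι : Type*} [Fintype ι] {d : ι → ℝ → ℝ} (hd0 : ∀ i x, 0 ≤ d i x)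
    (hd : ∀ i, Integrable (d i)) :
    Measure.pi (fun i => volume.withDensity fun x => ENNReal.ofReal (d i x))
      = (volume : Measure (ι → ℝ)).withDensity fun v => ENNReal.ofReal (∏ i, d i (v i)) := by
  refine Measure.pi_eq fun s hs => ?_
  rw [withDensity_apply _ (MeasurableSet.univ_pi hs), volume_pi, Measure.restrict_pi_pi,
    ← ofReal_integral_eq_lintegral_ofReal
      (Integrable.fintype_prod fun i => (hd i).restrict (s := s i))
      (ae_of_all _ fun v => Finset.prod_nonneg fun i _ => hd0 i _),
    integral_fintype_prod_eq_prod (fun i => d i),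
    ENNReal.ofReal_prod_of_nonneg fun i _ => integral_nonneg (hd0 i)]
  refine Finset.prod_congr rfl fun i _ => ?_
  rw [withDensity_apply _ (hs i), ofReal_integral_eq_lintegral_ofReal (hd i).restrict
    (ae_of_all _ (hd0 i))]

lemma measurableSet_simplexDomain (M : ℕ) : MeasurableSet (simplexDomain M) := by
  unfold simplexDomain
  measurability

section Signal

variable {Ω : Type*} [MeasurableSpace Ω] {μ : Measure Ω} {M : ℕ} {h : Fin M → Ω → ℂ}

/-- Since `h† h / |h| = |h|`, the terms add coherently; the convention `0 / 0 = 0` covers `h = 0`.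
-/
lemma signalPower_eq {Ω : Type*} (α : ℝ) {P : Fin M → ℝ} (a : Fin M → Plane) (h : Fin M → Ω → ℂ)
    (ω : Ω) : signalPower α P a h ω
      = (∑ m, Real.sqrt (P m) * ‖a m‖ ^ (-α / 2) * ‖h m ω‖) ^ 2 := by
  have h1 : ∀ m, (Real.sqrt (P m) : ℂ) * dbfWeight (h m ω) * h m ω * ((‖a m‖ ^ (-α / 2) : ℝ) : ℂ)
      = ((Real.sqrt (P m) * ‖a m‖ ^ (-α / 2) * ‖h m ω‖ : ℝ) : ℂ) := fun m => by
    have h2 : dbfWeight (h m ω) * h m ω = (‖h m ω‖ : ℂ) := by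
      rw [dbfWeight, div_mul_eq_mul_div, Complex.conj_mul']
      rcases eq_or_ne (h m ω) 0 with h0 | h0
      · simp [h0]
      · rw [pow_two, mul_div_cancel_right₀]
        exact_mod_cast norm_ne_zero_iff.2 h0
    rw [mul_assoc (Real.sqrt (P m) : ℂ), h2]
    push_cast
    ring
  rw [signalPower, Finset.sum_congr rfl fun m _ => h1 m, ← Complex.ofReal_sum, Complex.norm_real,
    Real.norm_eq_abs, sq_abs]

lemma measurable_signalPower {α : ℝ} {P : Fin M → ℝ} {a : Fin M → Plane}
    (hh : ∀ m, Measurable (h m)) : Measurable (signalPower α P a h) := by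
  rw [show signalPower α P a h = _ from funext (signalPower_eq α a h)]
  fun_prop

/-- The joint density of independent scaled Rayleigh moduli, integrated over the open simplex. -/
lemma measure_sum_norm_lt_one [IsProbabilityMeasure μ] (hh : ∀ m, Measurable (h m))
    (hlaw : ∀ m, HasLaw (h m) stdComplexGaussian μ) (hind : iIndepFun h μ)
    {k : Fin M → ℝ} (hk : ∀ m, 0 < k m) :
    μ {ω | ∑ m, k m * ‖h m ω‖ < 1} = ∫⁻ v in simplexDomain M,
      ENNReal.ofReal (∏ m, 2 * v m / k m ^ 2 * Real.exp (-(v m ^ 2 / k m ^ 2))) := by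
  set d : Fin M → ℝ → ℝ := fun m => (Set.Ici 0).indicator
    fun v => 2 * v / k m ^ 2 * Real.exp (-(v ^ 2 / k m ^ 2)) with hd
  have hd0 : ∀ m x, 0 ≤ d m x := fun m x =>
    Set.indicator_nonneg (fun v hv => by have : (0 : ℝ) ≤ v := hv; positivity) x
  have hdm : ∀ m, Measurable (d m) := fun m => Measurable.indicator (by fun_prop) measurableSet_Ici
  have hmeas : ∀ m, Measurable fun ω => k m * ‖h m ω‖ := fun m => by
    have := hh m
    fun_prop
  have hmap : ∀ m, μ.map (fun ω => k m * ‖h m ω‖)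
      = volume.withDensity fun x => ENNReal.ofReal (d m x) := fun m => by
    ext s hs
    rw [Measure.map_apply (hmeas m) hs, withDensity_apply _ hs, ← lintegral_indicator_one
      (hmeas m hs)]
    have h1 := lintegral_const_mul_norm_stdComplexGaussian (hk m)
      (measurable_one.indicator hs : Measurable (s.indicator (1 : ℝ → ℝ≥0∞)))
    rw [← (hlaw m).lintegral_comp (f := fun z => s.indicator (1 : ℝ → ℝ≥0∞) (k m * ‖z‖))
      (by
        have : Measurable (s.indicator (1 : ℝ → ℝ≥0∞)) := measurable_one.indicator hs
        fun_prop)] at h1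
    refine (Eq.trans (by rfl) h1).trans ?_
    rw [← setLIntegral_congr Ioi_ae_eq_Ici.symm, ← lintegral_indicator measurableSet_Ici,
      ← lintegral_indicator hs]
    refine lintegral_congr fun v => ?_
    by_cases hv : v ∈ Set.Ici (0 : ℝ) <;> by_cases hvs : v ∈ s <;> simp [hd, hv, hvs]
  -- Integrability needs no computation: by `hmap` the density has the total mass of a probability
  -- law.
  have hdi : ∀ m, Integrable (d m) := fun m => by
    refine ⟨(hdm m).aestronglyMeasurable, ?_⟩
    rw [hasFiniteIntegral_iff_ofReal (ae_of_all _ (hd0 m)), ← setLIntegral_univ,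
      ← withDensity_apply _ MeasurableSet.univ, ← hmap m, Measure.map_apply (hmeas m) MeasurableSet.univ]
    simp
  have hY : Measurable fun ω m => k m * ‖h m ω‖ := measurable_pi_lambda _ hmeas
  have hms : MeasurableSet {v : Fin M → ℝ | ∑ m, v m < 1} := by measurability
  have hjoint : μ.map (fun ω m => k m * ‖h m ω‖)
      = (volume : Measure (Fin M → ℝ)).withDensity fun v => ENNReal.ofReal (∏ i, d i (v i)) := by
    rw [← pi_withDensity_ofReal hd0 hdi, (iIndepFun_iff_map_fun_eq_pi_map fun m => (hmeas m).aemeasurable).1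
      (hind.comp (fun m z => k m * ‖z‖) fun m => by fun_prop)]
    simp_rw [hmap]
  change μ ((fun ω m => k m * ‖h m ω‖) ⁻¹' {v : Fin M → ℝ | ∑ m, v m < 1}) = _
  rw [← Measure.map_apply hY hms, hjoint, withDensity_apply _ hms, ← lintegral_indicator hms,
    ← lintegral_indicator (measurableSet_simplexDomain M)]
  refine lintegral_congr fun v => ?_
  by_cases h0 : ∀ m, 0 ≤ v m
  · by_cases h1 : ∑ m, v m < 1
    · rw [Set.indicator_of_mem (show v ∈ {v : Fin M → ℝ | ∑ m, v m < 1} from h1),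
        Set.indicator_of_mem (show v ∈ simplexDomain M from ⟨h0, h1⟩)]
      congr 1
      exact Finset.prod_congr rfl fun m _ => Set.indicator_of_mem (Set.mem_Ici.2 (h0 m)) _
    · rw [Set.indicator_of_notMem (show v ∉ {v : Fin M → ℝ | ∑ m, v m < 1} from h1),
        Set.indicator_of_notMem (fun hv => h1 hv.2)]
  · rw [Set.indicator_of_notMem (fun hv : v ∈ simplexDomain M => h0 hv.1)]
    obtain ⟨m, hm⟩ := not_forall.1 h0
    rw [Set.indicator_apply_eq_zero]
    intro _
    rw [Finset.prod_eq_zero (Finset.mem_univ m), ENNReal.ofReal_zero]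
    exact Set.indicator_of_notMem (by simpa using hm) _

/-- The distribution function of the received signal power. -/
lemma measure_signalPower_lt [IsProbabilityMeasure μ] (hh : ∀ m, Measurable (h m))
    (hlaw : ∀ m, HasLaw (h m) stdComplexGaussian μ) (hind : iIndepFun h μ) (α : ℝ)
    {P : Fin M → ℝ} (hP : ∀ m, 0 < P m) {a : Fin M → Plane} (ha : ∀ m, a m ≠ 0)
    {t : ℝ} (ht : 0 < t) :
    μ {ω | signalPower α P a h ω < t} = ∫⁻ v in simplexDomain M,
      ENNReal.ofReal (t ^ M * psi2 α P (fun m => ‖a m‖) v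
        * Real.exp (-(t * psi1 α P (fun m => ‖a m‖) v))) := by
  have hr : ∀ m, 0 < ‖a m‖ := fun m => norm_pos_iff.2 (ha m)
  have hst : 0 < Real.sqrt t := Real.sqrt_pos.2 ht
  -- Dividing by `√t` moves the dependence on `t` from the domain into the density. This is what
  -- later allows integration over the random level `t = βI`.
  set k : Fin M → ℝ := fun m => Real.sqrt (P m) * ‖a m‖ ^ (-α / 2) / Real.sqrt t with hkdef
  have hk : ∀ m, 0 < k m := fun m => by
    have := Real.sqrt_pos.2 (hP m)
    have := Real.rpow_pos_of_pos (hr m) (-α / 2)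
    simp only [hkdef]
    positivity
  have hset : {ω | signalPower α P a h ω < t} = {ω | ∑ m, k m * ‖h m ω‖ < 1} := by
    ext ω
    have hs : ∑ m, k m * ‖h m ω‖
        = (∑ m, Real.sqrt (P m) * ‖a m‖ ^ (-α / 2) * ‖h m ω‖) / Real.sqrt t := by
      rw [Finset.sum_div]
      exact Finset.sum_congr rfl fun m _ => by simp only [hkdef]; ring
    rw [Set.mem_ofPred_eq, Set.mem_ofPred_eq, hs, div_lt_one hst, signalPower_eq,
      Real.lt_sqrt (Finset.sum_nonneg fun m _ => by positivity)]
  have hk2 : ∀ m, k m ^ 2 = P m / (t * ‖a m‖ ^ α) := fun m => by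
    simp only [hkdef]
    rw [div_pow, mul_pow, Real.sq_sqrt (hP m).le, Real.sq_sqrt ht.le, ← Real.rpow_natCast,
      ← Real.rpow_mul (hr m).le, show -α / 2 * ((2 : ℕ) : ℝ) = -α by push_cast; ring,
      Real.rpow_neg (hr m).le]
    field_simp
  rw [hset, measure_sum_norm_lt_one hh hlaw hind hk]
  refine lintegral_congr fun v => ?_
  congr 1
  have h1 : ∀ m, 2 * v m / k m ^ 2 = t * (2 * ‖a m‖ ^ α * v m / P m) := fun m => by
    have := hP m
    have := Real.rpow_pos_of_pos (hr m) α
    rw [hk2]; field_simp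
  have h2 : ∀ m, -(v m ^ 2 / k m ^ 2) = -t * (‖a m‖ ^ α * v m ^ 2 / P m) := fun m => by
    have := hP m
    have := Real.rpow_pos_of_pos (hr m) α
    rw [hk2]; field_simp
  simp_rw [h1, h2]
  rw [Finset.prod_mul_distrib, Finset.prod_mul_distrib, Finset.prod_const, Finset.card_univ,
    Fintype.card_fin, ← Real.exp_sum, ← Finset.mul_sum, psi1, psi2, neg_mul]

end Signal


/-! ### Outage probability -/

section Connectivity

variable {Ω : Type*} [MeasurableSpace Ω] {μ : Measure Ω}

/-- If `X` is independent of `Y` and `(X, Y)` of `Z`, then `X` is independent of `(Y, Z)`. -/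
lemma indepFun_prodMk_of_indepFun_prodMk {β γ ε : Type*} [MeasurableSpace β] [MeasurableSpace γ]
    [MeasurableSpace ε] [IsProbabilityMeasure μ] {X : Ω → β} {Y : Ω → γ} {Z : Ω → ε}
    (hX : Measurable X) (hY : Measurable Y) (hZ : Measurable Z) (hXY : IndepFun X Y μ)
    (hXYZ : IndepFun (fun ω => (X ω, Y ω)) Z μ) : IndepFun X (fun ω => (Y ω, Z ω)) μ := by
  have hYZ : IndepFun Y Z μ := hXYZ.comp measurable_snd measurable_id
  have e1 := (indepFun_iff_map_prod_eq_prod_map_map hX.aemeasurable hY.aemeasurable).1 hXY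
  have e2 := (indepFun_iff_map_prod_eq_prod_map_map (hX.prodMk hY).aemeasurable
    hZ.aemeasurable).1 hXYZ
  have e3 := (indepFun_iff_map_prod_eq_prod_map_map hY.aemeasurable hZ.aemeasurable).1 hYZ
  have : IsProbabilityMeasure (μ.map X) := Measure.isProbabilityMeasure_map hX.aemeasurable
  have : IsProbabilityMeasure (μ.map Y) := Measure.isProbabilityMeasure_map hY.aemeasurable
  have : IsProbabilityMeasure (μ.map Z) := Measure.isProbabilityMeasure_map hZ.aemeasurable
  rw [indepFun_iff_map_prod_eq_prod_map_map hX.aemeasurable (hY.prodMk hZ).aemeasurable, e3,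
    ← (measurePreserving_prodAssoc (μ.map X) (μ.map Y) (μ.map Z)).map_eq, ← e1, ← e2,
    Measure.map_map MeasurableEquiv.prodAssoc.measurable ((hX.prodMk hY).prodMk hZ)]
  rfl

/-- Disjoint subfamilies of an independent family are independent. -/
lemma indepFun_of_iIndepFun_sumElim {ι κ β : Type*} [MeasurableSpace β] {X : ι → Ω → β}
    {Y : κ → Ω → β} (hX : ∀ i, Measurable (X i)) (hY : ∀ j, Measurable (Y j))
    (h : iIndepFun (Sum.elim X Y) μ) : IndepFun (fun ω i => X i ω) (fun ω j => Y j ω) μ := by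
  have hle : ∀ i, MeasurableSpace.comap (Sum.elim X Y i) inferInstance ≤ ‹MeasurableSpace Ω› := by
    rintro (i | j)
    · exact (hX i).comap_le
    · exact (hY j).comap_le
  have hd : Disjoint (Set.range (Sum.inl : ι → ι ⊕ κ)) (Set.range (Sum.inr : κ → ι ⊕ κ)) := by
    rw [Set.disjoint_left]
    rintro _ ⟨i, rfl⟩ ⟨j, hj⟩
    cases hj
  have key := indep_iSup_of_disjoint hle h hd
  rw [iSup_range, iSup_range] at key
  rw [IndepFun_iff_Indep]
  simp only [MeasurableSpace.pi, MeasurableSpace.comap_iSup, MeasurableSpace.comap_comp]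
  exact key

variable {M : ℕ} {hA : Fin M → Ω → ℂ} {hJ : ℕ → Ω → ℂ} {L : ℕ → Ω → Plane} {α PJ : ℝ}
  {P : Fin M → ℝ} {a : Fin M → Plane}

lemma indepFun_signalPower_interferencePower [IsProbabilityMeasure μ]
    (hAm : ∀ m, Measurable (hA m)) (hJm : ∀ j, Measurable (hJ j)) (hLm : ∀ j, Measurable (L j))
    (hind : iIndepFun (Sum.elim hA hJ) μ)
    (hLind : IndepFun (fun ω (i : Fin M ⊕ ℕ) => Sum.elim hA hJ i ω) (fun ω j => L j ω) μ) :
    IndepFun (signalPower α P a hA) (interferencePower α PJ L hJ) μ := by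
  have hAm' : Measurable fun ω m => hA m ω := measurable_pi_lambda _ hAm
  have hJm' : Measurable fun ω j => hJ j ω := measurable_pi_lambda _ hJm
  have hLm' : Measurable fun ω j => L j ω := measurable_pi_lambda _ hLm
  have h1 := indepFun_of_iIndepFun_sumElim hAm hJm hind
  have h2 : IndepFun (fun ω => ((fun m => hA m ω), fun j => hJ j ω)) (fun ω j => L j ω) μ :=
    hLind.comp (φ := fun (x : Fin M ⊕ ℕ → ℂ) => ((fun m => x (Sum.inl m)), fun j => x (Sum.inr j)))
      (by fun_prop) measurable_id
  have h3 := indepFun_prodMk_of_indepFun_prodMk hAm' hJm' hLm' h1 h2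
  -- Taking the coordinate space itself as sample space exhibits the signal power as a measurable
  -- function of the fading vector; `hI` does the same for the interference.
  have hS : Measurable fun x : Fin M → ℂ => signalPower α P a (fun m x => x m) x :=
    measurable_signalPower fun m => measurable_pi_apply m
  have hI : Measurable fun p : (ℕ → ℂ) × (ℕ → Plane) =>
      interferencePower α PJ (fun j p => p.2 j) (fun j p => p.1 j) p :=
    measurable_interferencePower (fun j => by fun_prop) (fun j => by fun_prop)
  exact h3.comp hS hI

lemma kappa_pos {δ : ℝ} (h0 : 0 < δ) (h1 : δ < 1) : 0 < kappa δ := by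
  have := Real.Gamma_pos_of_pos (show 0 < 1 + δ by linarith)
  have := Real.Gamma_pos_of_pos (show 0 < 1 - δ by linarith)
  unfold kappa
  positivity

lemma psi1_pos {r : Fin M → ℝ} (hP : ∀ m, 0 < P m) (hr : ∀ m, 0 < r m) {v : Fin M → ℝ}
    (hv : v ≠ 0) : 0 < psi1 α P r v := by
  obtain ⟨m, hm⟩ := Function.ne_iff.1 hv
  have hp : ∀ m, 0 < r m ^ α := fun m => Real.rpow_pos_of_pos (hr m) α
  refine Finset.sum_pos' (fun i _ => ?_) ⟨m, Finset.mem_univ m, ?_⟩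
  · have := hp i
    have := hP i
    positivity
  · have := hp m
    have := hP m
    have : v m ≠ 0 := hm
    positivity

lemma psi2_nonneg {r : Fin M → ℝ} (hP : ∀ m, 0 < P m) (hr : ∀ m, 0 < r m) {v : Fin M → ℝ}
    (hv : ∀ m, 0 ≤ v m) : 0 ≤ psi2 α P r v := by
  refine Finset.prod_nonneg fun m _ => ?_
  have := hP m
  have := hr m
  have := hv m
  positivity

/-- At `s = βψ₁` one has `K s^δ = κψ₀β^δ`, and `s^M = β^M ψ₁^M` accounts for the division by `ψ₁^M`.
-/
lemma dasIntegrand_eq_laplaceDeriv (hM : 1 ≤ M) {β lam : ℝ} (hβ : 0 < β)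
    {r : Fin M → ℝ} {v : Fin M → ℝ} (hψ : 0 < psi1 α P r v) :
    dasIntegrand α lam PJ β P r v = psi2 α P r v * β ^ M *
      laplaceDeriv (lam * kappa (2 / α) * PJ ^ (2 / α)) (2 / α) M (β * psi1 α P r v) := by
  have h := pow_mul_laplaceDeriv (lam * kappa (2 / α) * PJ ^ (2 / α)) (2 / α) hM (mul_pos hβ hψ)
  have e : lam * kappa (2 / α) * PJ ^ (2 / α) * (β * psi1 α P r v) ^ (2 / α)
      = kappa (2 / α) * psi0 α lam PJ P r v * β ^ (2 / α) := by
    rw [psi0, Real.mul_rpow hβ.le hψ.le]; ring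
  rw [e, mul_pow] at h
  have hψM : psi1 α P r v ^ M ≠ 0 := (pow_pos hψ M).ne'
  have h' : β ^ M * laplaceDeriv (lam * kappa (2 / α) * PJ ^ (2 / α)) (2 / α) M (β * psi1 α P r v)
      = Real.exp (-(kappa (2 / α) * psi0 α lam PJ P r v * β ^ (2 / α))) *
        (∑ i ∈ Finset.Icc 1 M, (2 / α * (kappa (2 / α) * psi0 α lam PJ P r v * β ^ (2 / α))) ^ i
          * upsilon (2 / α) M i) / psi1 α P r v ^ M := by
    rw [eq_div_iff hψM, ← h]; ring
  rw [mul_assoc, h', dasIntegrand]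
  simp only [← mul_assoc]
  ring

lemma measurable_dasIntegrand {β lam : ℝ} {r : Fin M → ℝ} :
    Measurable (dasIntegrand α lam PJ β P r) := by
  unfold dasIntegrand psi0 psi1 psi2
  fun_prop

/-- The outage probability and the nonnegativity of its density over the simplex. -/
lemma measure_signalPower_lt_interferencePower [IsProbabilityMeasure μ] (hM : 1 ≤ M) (hα : 2 < α)
    (hP : ∀ m, 0 < P m) (ha : ∀ m, a m ≠ 0) (hPJ : 0 < PJ) {lam : ℝ≥0} (hlam : 0 < lam)
    {β : ℝ} (hβ : 0 < β) (hL : IsHomogeneousPPP L lam μ)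
    (hAm : ∀ m, Measurable (hA m)) (hJm : ∀ j, Measurable (hJ j))
    (hA_law : ∀ m, HasLaw (hA m) stdComplexGaussian μ)
    (hJ_law : ∀ j, HasLaw (hJ j) stdComplexGaussian μ)
    (hind : iIndepFun (Sum.elim hA hJ) μ)
    (hLind : IndepFun (fun ω (i : Fin M ⊕ ℕ) => Sum.elim hA hJ i ω) (fun ω j => L j ω) μ) :
    (∀ᵐ v ∂volume.restrict (simplexDomain M), 0 ≤ dasIntegrand α lam PJ β P (fun m => ‖a m‖) v) ∧
    μ {ω | ENNReal.ofReal β ≤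
        sinr (signalPower α P a hA) (interferencePower α PJ L hJ) 0 ω}ᶜ
      = ∫⁻ v in simplexDomain M,
        ENNReal.ofReal (dasIntegrand α lam PJ β P (fun m => ‖a m‖) v) := by
  set S := signalPower α P a hA with hS
  set I := interferencePower α PJ L hJ with hI
  have hSm : Measurable S := measurable_signalPower hAm
  have hIm : Measurable I := measurable_interferencePower hL.measurable hJm
  have hr : ∀ m, 0 < ‖a m‖ := fun m => norm_pos_iff.2 (ha m)
  have hδ0 : 0 < 2 / α := by positivity
  have hδ1 : 2 / α < 1 := (div_lt_one (by linarith)).2 hα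
  set K : ℝ := lam * kappa (2 / α) * PJ ^ (2 / α) with hK
  have hlam' : (0 : ℝ) < lam := hlam
  have hK0 : 0 < K := by
    have := kappa_pos hδ0 hδ1
    positivity
  have hlap : ∀ s : ℝ, 0 < s →
      ∫⁻ ω, expNeg (ENNReal.ofReal s * I ω) ∂μ = ENNReal.ofReal (Real.exp (-(K * s ^ (2 / α)))) :=
    fun s hs => lintegral_expNeg_interferencePower hL hJm hJ_law
      (hind.precomp (g := Sum.inr) Sum.inr_injective)
      (hLind.comp (φ := fun (x : Fin M ⊕ ℕ → ℂ) j => x (Sum.inr j)) (by fun_prop) measurable_id)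
      hα hPJ hs
  have htop := ae_lt_top_of_laplace hIm hδ0 hlap
  have hne := ae_ne_zero_of_laplace hIm hδ0 hK0 hlap
  have hSI : IndepFun S I μ :=
    indepFun_signalPower_interferencePower hAm hJm hL.measurable hind hLind
  have hAind : iIndepFun hA μ := hind.precomp (g := Sum.inl) Sum.inl_injective
  have hmom := fun (v : Fin M → ℝ) (hv : v ≠ 0) => integral_pow_mul_exp_neg_of_laplace hIm hδ0 hlap M
    (mul_pos hβ (psi1_pos (α := α) hP hr hv))
  -- The origin, where `ψ₁ = 0`, is negligible only because `M ≥ 1`.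
  have hvne : ∀ᵐ v : Fin M → ℝ, v ≠ 0 := by
    have : Nonempty (Fin M) := ⟨⟨0, hM⟩⟩
    simp [ae_iff]
  have hdas : ∀ v ∈ simplexDomain M, v ≠ 0 →
      dasIntegrand α lam PJ β P (fun m => ‖a m‖) v
        = ∫ ω, psi2 α P (fun m => ‖a m‖) v * β ^ M * ((I ω).toReal ^ M *
          Real.exp (-(β * psi1 α P (fun m => ‖a m‖) v * (I ω).toReal))) ∂μ := fun v _ hv => by
    rw [integral_const_mul, (hmom v hv).2,
      dasIntegrand_eq_laplaceDeriv hM hβ (psi1_pos (α := α) hP hr hv)]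
  have hnn : ∀ v ∈ simplexDomain M, ∀ ω, 0 ≤ psi2 α P (fun m => ‖a m‖) v * β ^ M *
      ((I ω).toReal ^ M *
        Real.exp (-(β * psi1 α P (fun m => ‖a m‖) v * (I ω).toReal))) := fun v hv ω => by
    have := psi2_nonneg (α := α) hP hr hv.1
    positivity
  constructor
  · refine (ae_restrict_iff' (measurableSet_simplexDomain M)).2 (hvne.mono fun v hv hvs => ?_)
    rw [hdas v hvs hv]
    exact integral_nonneg (hnn v hvs)
  -- Outage in multiplicative form `S < βI`, equivalent to the quotient form when `I ≠ 0`.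
  set E : Set (ℝ × ℝ≥0∞) := {p | ENNReal.ofReal p.1 < ENNReal.ofReal β * p.2} with hE
  have hB : MeasurableSet E :=
    measurableSet_lt (by fun_prop) (by fun_prop)
  have hcdf : ∀ ω', 0 < I ω' → I ω' < ∞ →
      ∫⁻ ω, E.indicator 1 (S ω, I ω') ∂μ
        = ∫⁻ v in simplexDomain M, ENNReal.ofReal (psi2 α P (fun m => ‖a m‖) v * β ^ M *
          ((I ω').toReal ^ M *
            Real.exp (-(β * psi1 α P (fun m => ‖a m‖) v * (I ω').toReal)))) := by
    intro ω' h0 h1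
    have hx : 0 < (I ω').toReal := ENNReal.toReal_pos h0.ne' h1.ne
    have ht : 0 < β * (I ω').toReal := mul_pos hβ hx
    have hset : (fun ω => (S ω, I ω')) ⁻¹' E
        = {ω | signalPower α P a hA ω < β * (I ω').toReal} := by
      ext ω
      change ENNReal.ofReal (S ω) < ENNReal.ofReal β * I ω' ↔ _
      rw [← ENNReal.ofReal_toReal h1.ne, ← ENNReal.ofReal_mul hβ.le, ENNReal.ofReal_lt_ofReal_iff ht,
        ENNReal.toReal_ofReal hx.le]
      rfl
    have hmeas : Measurable fun ω => (S ω, I ω') := by fun_prop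
    have h2 := lintegral_indicator_one (μ := μ) (hmeas hB)
    rw [hset, measure_signalPower_lt hAm hA_law hAind α hP ha ht] at h2
    refine Eq.trans ?_ (h2.trans (lintegral_congr fun v => ?_))
    · rw [← hset]; rfl
    · rw [mul_pow]
      congr 1
      rw [show β * (I ω').toReal * psi1 α P (fun m => ‖a m‖) v
        = β * psi1 α P (fun m => ‖a m‖) v * (I ω').toReal by ring]
      ring
  have hae : ({ω | ENNReal.ofReal β ≤ sinr S I 0 ω}ᶜ : Set Ω) =ᵐ[μ]
      (fun ω => (S ω, I ω)) ⁻¹' E := by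
    filter_upwards [hne] with ω h0
    refine propext ?_
    change ¬ (ENNReal.ofReal β ≤ ENNReal.ofReal (S ω) / (I ω + 0)) ↔
      ENNReal.ofReal (S ω) < ENNReal.ofReal β * I ω
    rw [add_zero, ENNReal.le_div_iff_mul_le (Or.inl h0) (Or.inr ENNReal.ofReal_ne_top), not_le]
  have hmeas : Measurable fun ω => (S ω, I ω) := by fun_prop
  rw [measure_congr hae, ← lintegral_indicator_one (hmeas hB)]
  calc ∫⁻ ω, ((fun ω => (S ω, I ω)) ⁻¹' E).indicator 1 ω ∂μ
      = ∫⁻ ω', ∫⁻ ω, E.indicator 1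
          (S ω, I ω') ∂μ ∂μ :=
        lintegral_comp_pair_of_indepFun hSm hIm hSI (measurable_one.indicator hB)
    _ = ∫⁻ ω', (∫⁻ v in simplexDomain M, ENNReal.ofReal (psi2 α P (fun m => ‖a m‖) v * β ^ M *
          ((I ω').toReal ^ M *
            Real.exp (-(β * psi1 α P (fun m => ‖a m‖) v * (I ω').toReal))))) ∂μ := by
        refine lintegral_congr_ae ?_
        filter_upwards [hne, htop] with ω' h0 h1
        exact hcdf ω' (pos_iff_ne_zero.2 h0) h1
    _ = ∫⁻ v in simplexDomain M, ∫⁻ ω', ENNReal.ofReal (psi2 α P (fun m => ‖a m‖) v * β ^ M *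
          ((I ω').toReal ^ M *
            Real.exp (-(β * psi1 α P (fun m => ‖a m‖) v * (I ω').toReal)))) ∂μ := by
        -- Tonelli applies because the simplex is the same for every value of `I`.
        refine lintegral_lintegral_swap (Measurable.aemeasurable ?_)
        unfold Function.uncurry psi1 psi2
        fun_prop
    _ = _ := by
        refine lintegral_congr_ae ((ae_restrict_iff' (measurableSet_simplexDomain M)).2
          (hvne.mono fun v hv hvs => ?_))
        simp only
        rw [hdas v hvs hv, ofReal_integral_eq_lintegral_ofReal ((hmom v hv).1.const_mul _)
          (ae_of_all _ (hnn v hvs))]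

end Connectivity

end

end CovertDAS

/-! ### Reduction to measurable fading and conclusion -/

theorem mainTheorem3 {Ω : Type*} [MeasurableSpace Ω] (μ : Measure Ω) [IsProbabilityMeasure μ]
    (M : ℕ) (hM : 1 ≤ M)
    (α : ℝ) (hα : 2 < α)
    (P : Fin M → ℝ) (hP : ∀ m, 0 < P m)
    (a : Fin M → CovertDAS.Plane) (ha : ∀ m, a m ≠ 0)
    (PJ : ℝ) (hPJ : 0 < PJ)
    (lam : ℝ≥0) (hlam : 0 < lam)
    (β : ℝ) (hβ : 0 ≤ β)
    (L : ℕ → Ω → CovertDAS.Plane) (hL : CovertDAS.IsHomogeneousPPP L lam μ)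
    (hA : Fin M → Ω → ℂ) (hJ : ℕ → Ω → ℂ)
    (hA_law : ∀ m, HasLaw (hA m) CovertDAS.stdComplexGaussian μ)
    (hJ_law : ∀ j, HasLaw (hJ j) CovertDAS.stdComplexGaussian μ)
    (h_indep : iIndepFun (Sum.elim hA hJ) μ)
    (hL_indep : IndepFun (fun ω (i : Fin M ⊕ ℕ) => Sum.elim hA hJ i ω) (fun ω j => L j ω) μ) :
    IntegrableOn (CovertDAS.dasIntegrand α lam PJ β P (fun m => ‖a m‖))
        (CovertDAS.simplexDomain M) volume ∧
      CovertDAS.connectivityProb μ (CovertDAS.signalPower α P a hA)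
          (CovertDAS.interferencePower α PJ L hJ) 0 β =
        1 - ∫ v in CovertDAS.simplexDomain M,
          CovertDAS.dasIntegrand α lam PJ β P (fun m => ‖a m‖) v := by
  -- `HasLaw` gives only a.e. measurability. The countably many coefficients are replaced by
  -- measurable versions, which agree with them simultaneously almost surely.
  have hAeq : ∀ m, hA m =ᵐ[μ] (hA_law m).aemeasurable.mk := fun m => (hA_law m).aemeasurable.ae_eq_mk
  have hJeq : ∀ j, hJ j =ᵐ[μ] (hJ_law j).aemeasurable.mk := fun j => (hJ_law j).aemeasurable.ae_eq_mk
  set hA' : Fin M → Ω → ℂ := fun m => (hA_law m).aemeasurable.mk with hA'_def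
  set hJ' : ℕ → Ω → ℂ := fun j => (hJ_law j).aemeasurable.mk with hJ'_def
  have hsum : ∀ i, Sum.elim hA hJ i =ᵐ[μ] Sum.elim hA' hJ' i := by
    rintro (m | j)
    · exact hAeq m
    · exact hJeq j
  have hind' : iIndepFun (Sum.elim hA' hJ') μ := iIndepFun.congr hsum h_indep
  have hLind' : IndepFun (fun ω (i : Fin M ⊕ ℕ) => Sum.elim hA' hJ' i ω) (fun ω j => L j ω) μ := by
    refine hL_indep.congr ?_ Filter.EventuallyEq.rfl
    filter_upwards [ae_all_iff.2 hsum] with ω hω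
    exact funext hω
  have hevent : CovertDAS.connectivityProb μ (CovertDAS.signalPower α P a hA)
        (CovertDAS.interferencePower α PJ L hJ) 0 β
      = CovertDAS.connectivityProb μ (CovertDAS.signalPower α P a hA')
        (CovertDAS.interferencePower α PJ L hJ') 0 β := by
    refine measureReal_congr ?_
    filter_upwards [ae_all_iff.2 hAeq, ae_all_iff.2 hJeq] with ω h1 h2
    refine propext ?_
    change ENNReal.ofReal β ≤ _ ↔ ENNReal.ofReal β ≤ _
    simp only [CovertDAS.sinr, CovertDAS.signalPower, CovertDAS.interferencePower, h1, h2,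
      hA'_def, hJ'_def]
  have hAm : ∀ m, Measurable (hA' m) := fun m => (hA_law m).aemeasurable.measurable_mk
  have hJm : ∀ j, Measurable (hJ' j) := fun j => (hJ_law j).aemeasurable.measurable_mk
  rw [hevent]
  -- For `β = 0` the point `s = βψ₁` is not positive. The event is then certain, and the integrand
  -- vanishes because each `n` in the sum is at least one.
  rcases hβ.eq_or_lt with rfl | hβ
  · have hz : ∀ v, CovertDAS.dasIntegrand α lam PJ 0 P (fun m => ‖a m‖) v = 0 := fun v => by
      have hδ : 2 / α ≠ 0 := by positivity
      unfold CovertDAS.dasIntegrand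
      rw [Finset.sum_eq_zero, mul_zero]
      intro n hn
      rw [Real.zero_rpow hδ, mul_zero, zero_pow (by have := (Finset.mem_Icc.1 hn).1; omega), zero_mul]
    rw [show CovertDAS.dasIntegrand α lam PJ 0 P (fun m => ‖a m‖) = fun _ => 0 from funext hz]
    exact ⟨integrableOn_zero, by simp [CovertDAS.connectivityProb]⟩
  · obtain ⟨hnn, hout⟩ := CovertDAS.measure_signalPower_lt_interferencePower hM hα hP ha hPJ hlam hβ
      hL hAm hJm (fun m => (hA_law m).congr (hAeq m).symm) (fun j => (hJ_law j).congr (hJeq j).symm)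
      hind' hLind'
    have hdm := CovertDAS.measurable_dasIntegrand (α := α) (PJ := PJ) (P := P) (β := β)
      (lam := lam) (r := fun m => ‖a m‖)
    -- The integral of the nonnegative integrand is the outage probability, hence finite.
    have hint : IntegrableOn (CovertDAS.dasIntegrand α lam PJ β P (fun m => ‖a m‖))
        (CovertDAS.simplexDomain M) volume := by
      refine ⟨hdm.aestronglyMeasurable, ?_⟩
      rw [hasFiniteIntegral_iff_ofReal hnn, ← hout]
      exact measure_lt_top _ _
    refine ⟨hint, ?_⟩
    have hms : MeasurableSet {ω | ENNReal.ofReal β ≤ CovertDAS.sinr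
        (CovertDAS.signalPower α P a hA') (CovertDAS.interferencePower α PJ L hJ') 0 ω} :=
      measurableSet_le measurable_const
        ((ENNReal.measurable_ofReal.comp (CovertDAS.measurable_signalPower hAm)).div
          ((CovertDAS.measurable_interferencePower hL.measurable hJm).add_const 0))
    rw [integral_eq_lintegral_of_nonneg_ae hnn hdm.aestronglyMeasurable, ← hout,
      CovertDAS.connectivityProb, ← measureReal_def, probReal_compl_eq_one_sub hms]
    ring
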